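/- Let $m\geq 2$, let $d=(d_s)_{s\in\mathbb Z_m}$ and $(n_s)_{s\in\mathbb Z_m}$ be families of non-negative integers, and identify $\mathbb Z_m=\mathbb Z/m\mathbb Z$ with $\{0,\dots,m-1\}$. Let $\mathcal M$ be the affine space of all families of complex matrices $$X_s\in\mathrm{Mat}(n_s\times n_{s+1}),\quad Y_s\in\mathrm{Mat}(n_{s+1}\times n_s),\quad V_{s,\alpha}\in\mathrm{Mat}(1\times n_s),\quad W_{s,\alpha}\in\mathrm{Mat}(n_s\times 1),\qquad s\in\mathbb Z_m,\ 1\le\alpha\le d_s,$$ and let $\mathcal M^\bullet\subset\mathcal M$ be the open affine subvariety on which $\det(\mathrm{Id}+X_sY_s)$, $\det(\mathrm{Id}+Y_sX_s)$, $\det(\mathrm{Id}+W_{s,\alpha}V_{s,\alpha})$ and $1+V_{s,\alpha}W_{s,\alpha}$ are all non-zero. Endow the algebra $\mathcal O(\mathcal M^\bullet)$ of regular functions with the antisymmetric $\mathbb C$-bilinear biderivation $\{-,-\}$ (the quasi-Poisson bracket) determined by the following values on the matrix entries: $$\begin{aligned} \{(X_r)_{ij},(X_s)_{kl}\}={}&\tfrac12\delta_{s,r-1}(X_{r-1}X_r)_{kj}\delta_{il}-\tfrac12\delta_{s,r+1}\delta_{kj}(X_rX_{r+1})_{il},\\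 \{(Y_r)_{ij},(Y_s)_{kl}\}={}&\tfrac12\delta_{s,r-1}\delta_{kj}(Y_rY_{r-1})_{il}-\tfrac12\delta_{s,r+1}(Y_{r+1}Y_r)_{kj}\delta_{il},\\ \{(X_r)_{ij},(Y_s)_{kl}\}={}&\delta_{sr}\big(\delta_{kj}\delta_{il}+\tfrac12(Y_rX_r)_{kj}\delta_{il}+\tfrac12\delta_{kj}(X_rY_r)_{il}\big)\\ &-\tfrac12\delta_{s,r-1}(X_r)_{kj}(Y_{r-1})_{il}+\tfrac12\delta_{s,r+1}(Y_{r+1})_{kj}(X_r)_{il},\\ \{(X_r)_{ij},(W_{s,\alpha})_k\}={}&\tfrac12\delta_{s,r+1}\delta_{kj}(X_rW_{s,\alpha})_i-\tfrac12\delta_{rs}(X_r)_{kj}(W_{s,\alpha})_i,\\ \{(X_r)_{ij},(V_{s,\alpha})_l\}={}&\tfrac12\delta_{rs}(V_{s,\alpha}X_r)_j\delta_{il}-\tfrac12\delta_{s,r+1}(V_{s,\alpha})_j(X_r)_{il},\\ \{(Y_r)_{ij},(W_{s,\alpha})_k\}={}&\tfrac12\delta_{rs}\delta_{kj}(Y_rW_{s,\alpha})_i-\tfrac12\delta_{s,r+1}(Y_r)_{kj}(W_{s,\alpha})_i,\\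 \{(Y_r)_{ij},(V_{s,\alpha})_l\}={}&\tfrac12\delta_{s,r+1}(V_{s,\alpha}Y_r)_j\delta_{il}-\tfrac12\delta_{rs}(V_{s,\alpha})_j(Y_r)_{il},\\ \{(V_{s,\alpha})_j,(V_{r,\beta})_l\}={}&-\tfrac12o(s,r)(V_{s,\alpha})_j(V_{r,\beta})_l-\tfrac12\delta_{sr}o(\alpha,\beta)\big((V_{r,\beta})_j(V_{s,\alpha})_l+(V_{s,\alpha})_j(V_{r,\beta})_l\big),\\ \{(W_{s,\alpha})_i,(W_{r,\beta})_k\}={}&-\tfrac12o(s,r)(W_{r,\beta})_k(W_{s,\alpha})_i-\tfrac12\delta_{sr}o(\alpha,\beta)\big((W_{r,\beta})_k(W_{s,\alpha})_i+(W_{s,\alpha})_k(W_{r,\beta})_i\big),\\ \{(V_{s,\alpha})_j,(W_{r,\beta})_k\}={}&\tfrac12o(s,r)(W_{r,\beta})_k(V_{s,\alpha})_j\\ &+\delta_{sr}\delta_{\alpha\beta}\big(\delta_{kj}+\tfrac12(W_{r,\beta})_k(V_{s,\alpha})_j+\tfrac12\delta_{kj}(V_{s,\alpha}W_{r,\beta})\big)\\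 &+\tfrac12\delta_{sr}o(\alpha,\beta)\big(\delta_{kj}(V_{s,\alpha}W_{r,\beta})+(W_{r,\beta})_k(V_{s,\alpha})_j\big), \end{aligned}$$ where $o(a,b)=\mathrm{sgn}(b-a)$. (A term carrying a factor $\delta_{\cdot,\cdot}$ in the vertex indices is zero when that factor vanishes.) Put $T_s=\mathrm{Id}+X_sY_s\in\mathrm{End}(\mathbb C^{n_s})$, regard all the matrices as maps between the summands of $\mathbb C\oplus\bigoplus_{s\in\mathbb Z_m}\mathbb C^{n_s}$ extended by zero (so that $T_s^k$ denotes the $k$-th power in $\mathrm{End}(\mathbb C^{n_s})$, extended by zero), and let $$\mathcal H_+=\mathbb C\big[\mathrm{tr}(T_s^k)\mid s\in\mathbb Z_m,\,k\in\mathbb N\big],\qquad \mathcal I_+=\mathbb C\big[\mathrm{tr}(T_s^k),\ \mathrm{tr}(W_{p,\alpha}V_{q,\beta}T_s^k)\mid k\in\mathbb N,\ p,q,s\in\mathbb Z_m,\ 1\le\alpha\le d_p,\ 1\le\beta\le d_q\big]$$ be the subalgebras of $\mathcal O(\mathcal M^\bullet)$ generated by these functions. Call a subalgebra of $\mathcal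 O(\mathcal M^\bullet)$ a Poisson algebra if it is closed under $\{-,-\}$ and the restriction of $\{-,-\}$ to it is a Poisson bracket (an antisymmetric biderivation satisfying the Jacobi identity). Then: 1. $\mathcal H_+$ is an abelian Poisson algebra, i.e. a Poisson algebra on which $\{-,-\}$ vanishes identically; 2. $\{\mathrm{tr}(T_s^k),\mathrm{tr}(W_{p,\alpha}V_{q,\beta}T_r^l)\}=0$ for all $k,l\in\mathbb N$, all $s,r,p,q\in\mathbb Z_m$ and all $1\le\alpha\le d_p$, $1\le\beta\le d_q$; 3. $\mathcal I_+$ is a Poisson algebra; 4. $\mathcal H_+$ lies in the Poisson centre of $\mathcal I_+$, i.e. $\mathcal H_+\subset\mathcal I_+$ and $\{F,G\}=0$ for all $F\in\mathcal H_+$, $G\in\mathcal I_+$. -/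

import Mathlib

open scoped Matrix

noncomputable section

namespace CyclicQuiver

/-- The matrix entries parametrising representations of the doubled extended cyclic quiver:
for `s : ZMod m`, `X s i j` and `Y s i j` are entries of the `n s × n (s+1)` matrix `X_s` and of the
`n (s+1) × n s` matrix `Y_s`; for `α : Fin (d s)`, `V s α j` and `W s α i` are entries of the row
`V_{s,α}` and of the column `W_{s,α}`, both of length `n s`. -/
inductive Coord (m : ℕ) (d n : ZMod m → ℕ) : Type
  | X (s : ZMod m) (i : Fin (n s)) (j : Fin (n (s + 1)))
  | Y (s : ZMod m) (i : Fin (n (s + 1))) (j : Fin (n s))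
  | V (s : ZMod m) (α : Fin (d s)) (j : Fin (n s))
  | W (s : ZMod m) (α : Fin (d s)) (i : Fin (n s))
  deriving DecidableEq

section Coordinates

variable {m : ℕ} {d n : ZMod m → ℕ}

/-- The coordinates, sorted by their kind. -/
def Coord.equivSum : Coord m d n ≃
    ((Σ s : ZMod m, Fin (n s) × Fin (n (s + 1))) ⊕ (Σ s : ZMod m, Fin (n (s + 1)) × Fin (n s))) ⊕
    ((Σ s : ZMod m, Fin (d s) × Fin (n s)) ⊕ (Σ s : ZMod m, Fin (d s) × Fin (n s))) where
  toFun
    | .X s i j => .inl (.inl ⟨s, i, j⟩)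
    | .Y s i j => .inl (.inr ⟨s, i, j⟩)
    | .V s α j => .inr (.inl ⟨s, α, j⟩)
    | .W s α i => .inr (.inr ⟨s, α, i⟩)
  invFun
    | .inl (.inl ⟨s, i, j⟩) => .X s i j
    | .inl (.inr ⟨s, i, j⟩) => .Y s i j
    | .inr (.inl ⟨s, α, j⟩) => .V s α j
    | .inr (.inr ⟨s, α, i⟩) => .W s α i
  left_inv c := by cases c <;> rfl
  right_inv c := by rcases c with (⟨s, i, j⟩ | ⟨s, i, j⟩) | (⟨s, i, j⟩ | ⟨s, i, j⟩) <;> rfl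

instance Coord.instFintype [NeZero m] : Fintype (Coord m d n) :=
  Fintype.ofEquiv _ Coord.equivSum.symm

/-! ### The matrices of a representation with entries in a commutative ring -/

variable {R : Type*} [CommRing R] (x : Coord m d n → R)

/-- The matrix `X_s : 𝒱_{s+1} → 𝒱_s`. -/
def Xmat (s : ZMod m) : Matrix (Fin (n s)) (Fin (n (s + 1))) R := .of fun i j => x (.X s i j)

/-- The matrix `Y_s : 𝒱_s → 𝒱_{s+1}`. -/
def Ymat (s : ZMod m) : Matrix (Fin (n (s + 1))) (Fin (n s)) R := .of fun i j => x (.Y s i j)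

/-- The row vector `V_{s,α} : 𝒱_s → 𝒱_∞`. -/
def Vrow (s : ZMod m) (α : Fin (d s)) : Fin (n s) → R := fun j => x (.V s α j)

/-- The column vector `W_{s,α} : 𝒱_∞ → 𝒱_s`. -/
def Wcol (s : ZMod m) (α : Fin (d s)) : Fin (n s) → R := fun i => x (.W s α i)

/-- `T_s = Id + X_s Y_s`, an endomorphism of `𝒱_s`. -/
def Tmat (s : ZMod m) : Matrix (Fin (n s)) (Fin (n s)) R := 1 + Xmat x s * Ymat x s

/-! ### The same matrices as blocks of matrices acting on `𝒱_cyc = ⨁ 𝒱_s` -/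

/-- The index set of the standard basis of `𝒱_cyc`. -/
abbrev Idx (m : ℕ) (n : ZMod m → ℕ) : Type := Σ s : ZMod m, Fin (n s)

/-- The matrix of the inclusion `𝒱_s → 𝒱_cyc`; its transpose is the projection `𝒱_cyc → 𝒱_s`. -/
def incl (R : Type*) [CommRing R] {m : ℕ} (n : ZMod m → ℕ) (s : ZMod m) :
    Matrix (Idx m n) (Fin (n s)) R :=
  .of fun i a => if i = ⟨s, a⟩ then 1 else 0

/-- A linear map `𝒱_t → 𝒱_s`, extended by zero to an endomorphism of `𝒱_cyc`. -/
def block {s t : ZMod m} (M : Matrix (Fin (n s)) (Fin (n t)) R) :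
    Matrix (Idx m n) (Idx m n) R :=
  incl R n s * M * (incl R n t)ᵀ

variable [NeZero m]

/-- `X_s` as an endomorphism of `𝒱_cyc`. -/
def Xcyc (s : ZMod m) : Matrix (Idx m n) (Idx m n) R := block (Xmat x s)

/-- `Y_s` as an endomorphism of `𝒱_cyc`. -/
def Ycyc (s : ZMod m) : Matrix (Idx m n) (Idx m n) R := block (Ymat x s)

/-- `V_{s,α}` as a linear form on `𝒱_cyc`. -/
def Vcyc (s : ZMod m) (α : Fin (d s)) : Idx m n → R := incl R n s *ᵥ Vrow x s α

/-- `W_{s,α}` as a vector of `𝒱_cyc`. -/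
def Wcyc (s : ZMod m) (α : Fin (d s)) : Idx m n → R := incl R n s *ᵥ Wcol x s α

/-- The function `tr (T_s ^ k)`. -/
def traceT (s : ZMod m) (k : ℕ) : R := (Tmat x s ^ k).trace

/-- The function `tr (W_{p,α} V_{q,β} T_s ^ k)`, the trace of an endomorphism of `𝒱_cyc`. -/
def traceWVT (p : ZMod m) (α : Fin (d p)) (q : ZMod m) (β : Fin (d q)) (s : ZMod m) (k : ℕ) : R :=
  (Matrix.vecMulVec (Wcyc x p α) (Vcyc x q β) * block (Tmat x s ^ k)).trace

/-- The product of all the determinants whose non-vanishing defines the open subvariety `M^•`. -/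
def detProd : R :=
  (∏ s : ZMod m, (1 + Xmat x s * Ymat x s).det * (1 + Ymat x s * Xmat x s).det) *
  ∏ s : ZMod m, ∏ α : Fin (d s),
    (1 + Matrix.vecMulVec (Wcol x s α) (Vrow x s α)).det * (1 + Vrow x s α ⬝ᵥ Wcol x s α)

end Coordinates

/-! ### The ring of regular functions on `M^•` -/

/-- Regular functions on the affine space `M` of all the matrices `X_s, Y_s, V_{s,α}, W_{s,α}`. -/
abbrev PolyRing (m : ℕ) (d n : ZMod m → ℕ) : Type := MvPolynomial (Coord m d n) ℂ

variable {m : ℕ} [NeZero m] (d n : ZMod m → ℕ)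

/-- Regular functions on `M^•`, the principal open subset of `M` where all the determinants
of `detProd` are non-zero. -/
abbrev Reg : Type :=
  Localization.Away (detProd (MvPolynomial.X : Coord m d n → PolyRing m d n))

/-- The coordinate functions on `M^•`. -/
def coord (c : Coord m d n) : Reg d n := algebraMap (PolyRing m d n) (Reg d n) (MvPolynomial.X c)

variable {d n}

/-- The algebra morphism `F ↦ F + ε ∂F/∂a` on polynomials. -/
def taylorPoly (a : Coord m d n) : PolyRing m d n →ₐ[ℂ] TrivSqZeroExt (Reg d n) (Reg d n) :=
  MvPolynomial.aeval fun b =>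
    TrivSqZeroExt.inl (coord d n b) + TrivSqZeroExt.inr (if b = a then 1 else 0)

theorem fst_taylorPoly (a : Coord m d n) (F : PolyRing m d n) :
    (taylorPoly a F).fst = algebraMap _ (Reg d n) F := by
  have h : (TrivSqZeroExt.fstHom ℂ (Reg d n) (Reg d n)).comp (taylorPoly a) =
      IsScalarTower.toAlgHom ℂ (PolyRing m d n) (Reg d n) := by
    apply MvPolynomial.algHom_ext
    intro b
    change (taylorPoly a (MvPolynomial.X b)).fst = coord d n b
    rw [taylorPoly, MvPolynomial.aeval_X, TrivSqZeroExt.fst_add, TrivSqZeroExt.fst_inl,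
      TrivSqZeroExt.fst_inr, add_zero]
  exact DFunLike.congr_fun h F

/-- The algebra morphism `F ↦ F + ε ∂F/∂a` on regular functions on `M^•`. -/
def taylor (a : Coord m d n) : Reg d n →ₐ[ℂ] TrivSqZeroExt (Reg d n) (Reg d n) :=
  IsLocalization.liftAlgHom
    (M := Submonoid.powers (detProd (MvPolynomial.X : Coord m d n → PolyRing m d n)))
    (f := taylorPoly a) fun y => by
      rw [TrivSqZeroExt.isUnit_iff_isUnit_fst, fst_taylorPoly]
      exact IsLocalization.map_units _ y

theorem taylor_algebraMap (a : Coord m d n) (F : PolyRing m d n) :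
    taylor a (algebraMap _ (Reg d n) F) = taylorPoly a F := by
  simp [taylor]

theorem fst_taylor (a : Coord m d n) (F : Reg d n) : (taylor a F).fst = F := by
  have h : (TrivSqZeroExt.fstHom ℂ (Reg d n) (Reg d n)).comp (taylor a) = AlgHom.id ℂ _ := by
    apply IsLocalization.algHom_ext
      (Submonoid.powers (detProd (MvPolynomial.X : Coord m d n → PolyRing m d n)))
    apply AlgHom.ext
    intro G
    change (taylor a (algebraMap _ (Reg d n) G)).fst = algebraMap _ (Reg d n) G
    rw [taylor_algebraMap, fst_taylorPoly]
  exact DFunLike.congr_fun h F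

/-- The partial derivative `∂/∂a` on regular functions on `M^•`. -/
def partialDeriv (a : Coord m d n) : Derivation ℂ (Reg d n) (Reg d n) :=
  Derivation.mk'
    { toFun := fun F => (taylor a F).snd
      map_add' := fun F G => by rw [map_add, TrivSqZeroExt.snd_add]
      map_smul' := fun c F => by
        rw [map_smul, TrivSqZeroExt.snd_smul, RingHom.id_apply] }
    fun F G => by
      change (taylor a (F * G)).snd = F • (taylor a G).snd + G • (taylor a F).snd
      rw [map_mul, TrivSqZeroExt.snd_mul, fst_taylor, fst_taylor, op_smul_eq_smul]

theorem partialDeriv_coord (a b : Coord m d n) :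
    partialDeriv a (coord d n b) = if b = a then 1 else 0 := by
  change (taylor a (algebraMap _ (Reg d n) (MvPolynomial.X b))).snd = _
  rw [taylor_algebraMap, taylorPoly, MvPolynomial.aeval_X, TrivSqZeroExt.snd_add,
    TrivSqZeroExt.snd_inl, TrivSqZeroExt.snd_inr, zero_add]

/-! ### The quasi-Poisson bracket -/

/-- The ordering function of `ZMod m`, identified with `{0, …, m-1}`: `o(s,r) = sgn (r - s)`. -/
def ordZ {m : ℕ} (s r : ZMod m) : ℂ := (SignType.sign ((r.val : ℤ) - (s.val : ℤ)) : ℤ)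

/-- The ordering function of the spin indices at a vertex: `o(α,β) = sgn (β - α)`. -/
def ordF {a b : ℕ} (α : Fin a) (β : Fin b) : ℂ :=
  (SignType.sign (((β : ℕ) : ℤ) - ((α : ℕ) : ℤ)) : ℤ)

/-- The Kronecker delta. -/
def delta {ι : Type*} [DecidableEq ι] (i j : ι) : ℂ := if i = j then 1 else 0

section Formulas

variable (d n)

local notation "𝐗" => Xcyc (coord d n)
local notation "𝐘" => Ycyc (coord d n)
local notation "𝐕" => Vcyc (coord d n)
local notation "𝐖" => Wcyc (coord d n)

/-- `{(X_r)_{ij}, (X_s)_{kl}}` -/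
def brXX (r s : ZMod m) (i j k l : Idx m n) : Reg d n :=
  (1 / 2 * delta s (r - 1) * delta i l) • (𝐗 (r - 1) * 𝐗 r) k j
    - (1 / 2 * delta s (r + 1) * delta k j) • (𝐗 r * 𝐗 (r + 1)) i l

/-- `{(Y_r)_{ij}, (Y_s)_{kl}}` -/
def brYY (r s : ZMod m) (i j k l : Idx m n) : Reg d n :=
  (1 / 2 * delta s (r - 1) * delta k j) • (𝐘 r * 𝐘 (r - 1)) i l
    - (1 / 2 * delta s (r + 1) * delta i l) • (𝐘 (r + 1) * 𝐘 r) k j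

/-- `{(X_r)_{ij}, (Y_s)_{kl}}` -/
def brXY (r s : ZMod m) (i j k l : Idx m n) : Reg d n :=
  delta s r • ((delta k j * delta i l) • (1 : Reg d n)
      + (1 / 2 * delta i l) • (𝐘 r * 𝐗 r) k j
      + (1 / 2 * delta k j) • (𝐗 r * 𝐘 r) i l)
    - (1 / 2 * delta s (r - 1)) • (𝐗 r k j * 𝐘 (r - 1) i l)
    + (1 / 2 * delta s (r + 1)) • (𝐘 (r + 1) k j * 𝐗 r i l)

/-- `{(X_r)_{ij}, (W_{s,α})_k}` -/
def brXW (r s : ZMod m) (α : Fin (d s)) (i j k : Idx m n) : Reg d n :=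
  (1 / 2 * delta s (r + 1) * delta k j) • (𝐗 r *ᵥ 𝐖 s α) i
    - (1 / 2 * delta r s) • (𝐗 r k j * 𝐖 s α i)

/-- `{(X_r)_{ij}, (V_{s,α})_l}` -/
def brXV (r s : ZMod m) (α : Fin (d s)) (i j l : Idx m n) : Reg d n :=
  (1 / 2 * delta r s * delta i l) • (𝐕 s α ᵥ* 𝐗 r) j
    - (1 / 2 * delta s (r + 1)) • (𝐕 s α j * 𝐗 r i l)

/-- `{(Y_r)_{ij}, (W_{s,α})_k}` -/
def brYW (r s : ZMod m) (α : Fin (d s)) (i j k : Idx m n) : Reg d n :=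
  (1 / 2 * delta r s * delta k j) • (𝐘 r *ᵥ 𝐖 s α) i
    - (1 / 2 * delta s (r + 1)) • (𝐘 r k j * 𝐖 s α i)

/-- `{(Y_r)_{ij}, (V_{s,α})_l}` -/
def brYV (r s : ZMod m) (α : Fin (d s)) (i j l : Idx m n) : Reg d n :=
  (1 / 2 * delta s (r + 1) * delta i l) • (𝐕 s α ᵥ* 𝐘 r) j
    - (1 / 2 * delta r s) • (𝐕 s α j * 𝐘 r i l)

/-- `{(V_{s,α})_j, (V_{r,β})_l}` -/
def brVV (s : ZMod m) (α : Fin (d s)) (r : ZMod m) (β : Fin (d r)) (j l : Idx m n) : Reg d n :=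
  -((1 / 2 * ordZ s r) • (𝐕 s α j * 𝐕 r β l))
    - (1 / 2 * delta s r * ordF α β) • (𝐕 r β j * 𝐕 s α l + 𝐕 s α j * 𝐕 r β l)

/-- `{(W_{s,α})_i, (W_{r,β})_k}` -/
def brWW (s : ZMod m) (α : Fin (d s)) (r : ZMod m) (β : Fin (d r)) (i k : Idx m n) : Reg d n :=
  -((1 / 2 * ordZ s r) • (𝐖 r β k * 𝐖 s α i))
    - (1 / 2 * delta s r * ordF α β) • (𝐖 r β k * 𝐖 s α i + 𝐖 s α k * 𝐖 r β i)

/-- `{(V_{s,α})_j, (W_{r,β})_k}` -/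
def brVW (s : ZMod m) (α : Fin (d s)) (r : ZMod m) (β : Fin (d r)) (j k : Idx m n) : Reg d n :=
  (1 / 2 * ordZ s r) • (𝐖 r β k * 𝐕 s α j)
    + (delta s r * delta (α : ℕ) (β : ℕ)) • (delta k j • (1 : Reg d n)
        + (1 / 2 : ℂ) • (𝐖 r β k * 𝐕 s α j)
        + (1 / 2 * delta k j) • (𝐕 s α ⬝ᵥ 𝐖 r β))
    + (1 / 2 * delta s r * ordF α β) • (delta k j • (𝐕 s α ⬝ᵥ 𝐖 r β) + 𝐖 r β k * 𝐕 s α j)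

/-- The quasi-Poisson brackets of the coordinate functions; the brackets not listed explicitly are
obtained by antisymmetry. -/
def brCoord : Coord m d n → Coord m d n → Reg d n
  | .X r i j, .X s k l => brXX d n r s ⟨r, i⟩ ⟨r + 1, j⟩ ⟨s, k⟩ ⟨s + 1, l⟩
  | .X r i j, .Y s k l => brXY d n r s ⟨r, i⟩ ⟨r + 1, j⟩ ⟨s + 1, k⟩ ⟨s, l⟩
  | .X r i j, .V s α l => brXV d n r s α ⟨r, i⟩ ⟨r + 1, j⟩ ⟨s, l⟩
  | .X r i j, .W s α k => brXW d n r s α ⟨r, i⟩ ⟨r + 1, j⟩ ⟨s, k⟩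
  | .Y s k l, .X r i j => -brXY d n r s ⟨r, i⟩ ⟨r + 1, j⟩ ⟨s + 1, k⟩ ⟨s, l⟩
  | .Y r i j, .Y s k l => brYY d n r s ⟨r + 1, i⟩ ⟨r, j⟩ ⟨s + 1, k⟩ ⟨s, l⟩
  | .Y r i j, .V s α l => brYV d n r s α ⟨r + 1, i⟩ ⟨r, j⟩ ⟨s, l⟩
  | .Y r i j, .W s α k => brYW d n r s α ⟨r + 1, i⟩ ⟨r, j⟩ ⟨s, k⟩
  | .V s α l, .X r i j => -brXV d n r s α ⟨r, i⟩ ⟨r + 1, j⟩ ⟨s, l⟩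
  | .V s α l, .Y r i j => -brYV d n r s α ⟨r + 1, i⟩ ⟨r, j⟩ ⟨s, l⟩
  | .V s α j, .V r β l => brVV d n s α r β ⟨s, j⟩ ⟨r, l⟩
  | .V s α j, .W r β k => brVW d n s α r β ⟨s, j⟩ ⟨r, k⟩
  | .W s α k, .X r i j => -brXW d n r s α ⟨r, i⟩ ⟨r + 1, j⟩ ⟨s, k⟩
  | .W s α k, .Y r i j => -brYW d n r s α ⟨r + 1, i⟩ ⟨r, j⟩ ⟨s, k⟩
  | .W r β k, .V s α j => -brVW d n s α r β ⟨s, j⟩ ⟨r, k⟩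
  | .W s α i, .W r β k => brWW d n s α r β ⟨s, i⟩ ⟨r, k⟩

/-- The quasi-Poisson bracket on `M^•`: the biderivation of the ring of regular functions with the
prescribed values on the coordinate functions. -/
def bracket : Reg d n →ₗ[ℂ] Reg d n →ₗ[ℂ] Reg d n :=
  LinearMap.mk₂ ℂ (fun F G => ∑ a, ∑ b, partialDeriv a F * partialDeriv b G * brCoord d n a b)
    (fun F F' G => by simp only [map_add, add_mul, Finset.sum_add_distrib])
    (fun c F G => by simp only [Derivation.map_smul, smul_mul_assoc, Finset.smul_sum])
    (fun F G G' => by simp only [map_add, mul_add, add_mul, Finset.sum_add_distrib])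
    (fun c F G => by
      simp only [Derivation.map_smul, mul_smul_comm, smul_mul_assoc, Finset.smul_sum])

theorem bracket_coord (a b : Coord m d n) :
    bracket d n (coord d n a) (coord d n b) = brCoord d n a b := by
  change ∑ a', ∑ b', partialDeriv a' (coord d n a) * partialDeriv b' (coord d n b) *
    brCoord d n a' b' = _
  simp [partialDeriv_coord]

/-- The algebra `ℋ₊` generated by the functions `tr (T_s ^ k)`. -/
def Hplus : Subalgebra ℂ (Reg d n) :=
  Algebra.adjoin ℂ {F | ∃ (s : ZMod m) (k : ℕ), F = traceT (coord d n) s k}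

/-- The algebra `ℐ₊` generated by the functions `tr (T_s ^ k)` and
`tr (W_{p,α} V_{q,β} T_s ^ k)`. -/
def Iplus : Subalgebra ℂ (Reg d n) :=
  Algebra.adjoin ℂ
    ({F | ∃ (s : ZMod m) (k : ℕ), F = traceT (coord d n) s k} ∪
     {F | ∃ (p : ZMod m) (α : Fin (d p)) (q : ZMod m) (β : Fin (d q)) (s : ZMod m) (k : ℕ),
        F = traceWVT (coord d n) p α q β s k})

end Formulas

end CyclicQuiver

/-- A subalgebra `S` of a commutative algebra, endowed with a bilinear bracket `br`, is a Poisson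
algebra for `br`: it is closed under `br`, and `br` restricts to a Lie bracket on `S` that is a
derivation in each argument (in the second by `leibniz`, hence in the first by `skew`). -/
structure IsPoissonSubalgebra {A : Type*} [CommRing A] [Algebra ℂ A] (br : A →ₗ[ℂ] A →ₗ[ℂ] A)
    (S : Subalgebra ℂ A) : Prop where
  closed : ∀ F ∈ S, ∀ G ∈ S, br F G ∈ S
  skew : ∀ F ∈ S, ∀ G ∈ S, br F G = -br G F
  leibniz : ∀ F ∈ S, ∀ G ∈ S, ∀ H ∈ S, br F (G * H) = br F G * H + G * br F H
  jacobi : ∀ F ∈ S, ∀ G ∈ S, ∀ H ∈ S,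
    br F (br G H) + br G (br H F) + br H (br F G) = 0

end

/-! The bracket on all regular functions is only quasi-Poisson, so the Jacobi identity has to come
from invariance under changes of basis. All computations use twice the bracket, which has integral
coefficients.

Leibniz applied to `T_s = 1 + X_s Y_s` gives the brackets of its entries with those of `T`, `V` and
`W`. The terms linking neighbouring vertices cancel, and what remains is closed in `T`, `V`, `W`:
entries of `T_s` commute with everything at another vertex, while entries of `V_r`, `W_r` act on
`V_s` and `W_s` by opposite scalings (`QuiverRelations`).

At one vertex the Jacobiator of three entries is the Cartan trivector `tr (M_x [M_y, M_z])`, where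
`tr (M_x M)` is the derivative of the entry `x` under the infinitesimal change of basis `M`
(`jacobiator_eq_cartan`). The Jacobiator is a derivation in each argument. With two arguments fixed
in the algebra of entries, it is therefore an infinitesimal change of basis in the third
(`exists_jacobiator_eq_trace`), and it kills the invariant functions `V T ^ k W`
(`jacobiator_spin_eq_zero`).

The functions `tr (T ^ k)` commute with every entry of `T`, `V` and `W`, because the brackets of an
entry with `T ^ k` telescope and their traces cancel. The functions `V T ^ k W` at one vertex
generate an algebra closed under the bracket (`bracket_spin_spin_mem`). Those at different vertices
commute, since the opposite scalings of `V` and `W` compensate (`bracket_spin_spin_of_ne`). Hence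
the Jacobiator vanishes on generators: either some argument is a central trace, or some argument
lies at a vertex of its own, or all three lie at one vertex.

Finally `tr (W_p V_q T_s ^ k)` is zero unless `p = q = s`, so these generators are exactly those of
`ℐ₊`, up to zeros (`Iplus_eq`). -/

noncomputable section

/-! ### Skew-symmetric biderivations -/

section Biderivation

variable {R A : Type*} [CommRing R] [CommRing A] [Algebra R A]

/-- A bilinear bracket is a skew-symmetric biderivation. -/
structure IsSkewBiderivation (B : A →ₗ[R] A →ₗ[R] A) : Prop where
  skew : ∀ F G, B F G = -B G F
  leibniz : ∀ F G H, B F (G * H) = B F G * H + G * B F H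

/-- The cyclic sum whose vanishing is the Jacobi identity. -/
def jacobiator (B : A →ₗ[R] A →ₗ[R] A) (F G H : A) : A :=
  B F (B G H) + B G (B H F) + B H (B F G)

theorem jacobiator_rotate (B : A →ₗ[R] A →ₗ[R] A) (F G H : A) :
    jacobiator B G H F = jacobiator B F G H := by
  simp only [jacobiator]; ring

theorem jacobiator_add (B : A →ₗ[R] A →ₗ[R] A) (F G H H' : A) :
    jacobiator B F G (H + H') = jacobiator B F G H + jacobiator B F G H' := by
  simp only [jacobiator, map_add, LinearMap.add_apply]; ring

/-- A biderivation, with its second argument fixed. -/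
def IsSkewBiderivation.derivLeft {B : A →ₗ[R] A →ₗ[R] A} (hB : IsSkewBiderivation B) (G : A) :
    Derivation R A A :=
  Derivation.mk' (B.flip G) fun F F' => by
    simp only [LinearMap.flip_apply, smul_eq_mul]
    rw [hB.skew, hB.leibniz, hB.skew F G, hB.skew F' G]
    ring

/-- A biderivation, with its first argument fixed. -/
def IsSkewBiderivation.derivRight {B : A →ₗ[R] A →ₗ[R] A} (hB : IsSkewBiderivation B) (F : A) :
    Derivation R A A :=
  Derivation.mk' (B F) fun G G' => by
    rw [hB.leibniz, smul_eq_mul, smul_eq_mul]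
    ring

namespace IsSkewBiderivation

variable {B : A →ₗ[R] A →ₗ[R] A}

@[simp] theorem derivLeft_apply (hB : IsSkewBiderivation B) (F G : A) : hB.derivLeft G F = B F G := rfl

@[simp] theorem derivRight_apply (hB : IsSkewBiderivation B) (F G : A) : hB.derivRight F G = B F G := rfl

theorem leibniz_left (hB : IsSkewBiderivation B) (F G H : A) : B (F * G) H = B F H * G + F * B G H := by
  have := (hB.derivLeft H).leibniz F G
  simp only [derivLeft_apply, smul_eq_mul] at this
  rw [this]; ring

theorem map_one_right (hB : IsSkewBiderivation B) (F : A) : B F 1 = 0 := (hB.derivRight F).map_one_eq_zero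

theorem map_algebraMap_right (hB : IsSkewBiderivation B) (F : A) (r : R) : B F (algebraMap R A r) = 0 :=
  (hB.derivRight F).map_algebraMap r

theorem jacobiator_swap (hB : IsSkewBiderivation B) (F G H : A) : jacobiator B F H G = -jacobiator B F G H := by
  simp only [jacobiator]
  rw [hB.skew H G, hB.skew G F, hB.skew F H]
  simp only [map_neg]
  ring

/-- The mixed products, such as `B F H * B G H'`, cancel in pairs by skew-symmetry. The Jacobiator
is thus determined by its values on generators. -/
theorem jacobiator_mul (hB : IsSkewBiderivation B) (F G H H' : A) :
    jacobiator B F G (H * H') = jacobiator B F G H * H' + H * jacobiator B F G H' := by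
  simp only [jacobiator, hB.leibniz, hB.leibniz_left, map_add]
  rw [hB.skew H F, hB.skew H' F]
  simp only [map_neg]
  ring

theorem jacobiator_algebraMap (hB : IsSkewBiderivation B) (F G : A) (r : R) : jacobiator B F G (algebraMap R A r) = 0 := by
  have h : ∀ K, B (algebraMap R A r) K = 0 := fun K => by
    rw [hB.skew, hB.map_algebraMap_right, neg_zero]
  simp [jacobiator, hB.map_algebraMap_right, h]

/-- The Jacobiator is a derivation in its first argument. -/
def derivJacobiator (hB : IsSkewBiderivation B) (G H : A) : Derivation R A A :=
  Derivation.mk'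
    { toFun := fun F => jacobiator B F G H
      map_add' := fun F F' => by
        simp only [jacobiator, map_add, LinearMap.add_apply]; ring
      map_smul' := fun r F => by
        simp only [jacobiator, map_smul, LinearMap.smul_apply, RingHom.id_apply, smul_add] }
    fun F F' => by
      change jacobiator B (F * F') G H = F • jacobiator B F' G H + F' • jacobiator B F G H
      rw [← jacobiator_rotate, hB.jacobiator_mul, jacobiator_rotate B F, jacobiator_rotate B F', smul_eq_mul,
        smul_eq_mul]
      ring

end IsSkewBiderivation

end Biderivation

/-! ### Derivations of matrices -/

namespace Derivation

variable {R A : Type*} [CommRing R] [CommRing A] [Algebra R A] (D : Derivation R A A)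
variable {l m n : Type*}

theorem map_matrix_mul [Fintype m] (M : Matrix l m A) (N : Matrix m n A) :
    (M * N).map D = M.map D * N + M * N.map D := by
  ext i j
  simp only [Matrix.map_apply, Matrix.mul_apply, map_sum, leibniz, smul_eq_mul,
    Finset.sum_add_distrib, Matrix.add_apply]
  rw [add_comm]
  simp only [mul_comm]

theorem map_matrix_one [DecidableEq n] : (1 : Matrix n n A).map D = 0 := by
  ext i j
  by_cases h : i = j <;> simp [h]

/-- A derivation that acts on a matrix as an infinitesimal conjugation acts so on its powers. -/
theorem map_matrix_pow_of_commutator [Fintype n] [DecidableEq n] {T M : Matrix n n A}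
    (hT : T.map D = T * M - M * T) (k : ℕ) : (T ^ k).map D = T ^ k * M - M * T ^ k := by
  induction k with
  | zero => simp [map_matrix_one]
  | succ k ih => rw [pow_succ, map_matrix_mul, ih, hT]; noncomm_ring

/-- A derivation that acts as an infinitesimal change of basis annihilates the functions
`V T ^ k W`. -/
theorem map_matrix_mul_pow_mul_eq_zero [Fintype n] [DecidableEq n] {T M : Matrix n n A} {V : Matrix l n A}
    {W : Matrix n m A} (hT : T.map D = T * M - M * T) (hV : V.map D = V * M)
    (hW : W.map D = -(M * W)) (k : ℕ) : (V * T ^ k * W).map D = 0 := by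
  rw [map_matrix_mul, map_matrix_mul, map_matrix_pow_of_commutator D hT, hV, hW]
  simp only [Matrix.add_mul, Matrix.mul_sub, Matrix.sub_mul, Matrix.mul_neg, Matrix.mul_assoc]
  abel

end Derivation

/-! ### Products of columns and rows of matrices -/

namespace Matrix

variable {A : Type*} [CommRing A] {k l m n p q r : Type*}

/-- The product of the column `j` of `M` with the row `i` of `N`. -/
def colMulRow (M : Matrix k l A) (N : Matrix m n A) (j : l) (i : m) : Matrix k n A :=
  of fun a b => M a j * N i b

@[simp] theorem colMulRow_apply (M : Matrix k l A) (N : Matrix m n A) (j : l) (i : m) (a : k)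
    (b : n) : colMulRow M N j i a b = M a j * N i b := rfl

theorem mul_colMulRow [Fintype k] (P : Matrix p k A) (M : Matrix k l A) (N : Matrix m n A) (j : l)
    (i : m) : P * colMulRow M N j i = colMulRow (P * M) N j i := by
  ext a b
  simp only [mul_apply, colMulRow_apply, Finset.sum_mul, mul_assoc]

theorem colMulRow_mul [Fintype n] (P : Matrix n p A) (M : Matrix k l A) (N : Matrix m n A) (j : l)
    (i : m) : colMulRow M N j i * P = colMulRow M (N * P) j i := by
  ext a b
  simp only [mul_apply, colMulRow_apply, Finset.mul_sum, mul_assoc]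

theorem trace_colMulRow [Fintype k] (M : Matrix k l A) (N : Matrix m k A) (j : l) (i : m) :
    (colMulRow M N j i).trace = (N * M) i j := by
  simp only [trace, diag, mul_apply, colMulRow_apply, mul_comm]

/-- A matrix with its rows multiplied by scalars. -/
def rowScale (c : k → A) (M : Matrix k l A) : Matrix k l A := of fun i j => c i * M i j

@[simp] theorem rowScale_apply (c : k → A) (M : Matrix k l A) (i : k) (j : l) :
    rowScale c M i j = c i * M i j := rfl

theorem rowScale_mul [Fintype l] (c : k → A) (M : Matrix k l A) (N : Matrix l m A) :
    rowScale c M * N = rowScale c (M * N) := by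
  ext i j
  simp only [mul_apply, rowScale_apply, Finset.mul_sum, mul_assoc]

/-- A matrix with its columns multiplied by scalars. -/
def colScale (c : l → A) (M : Matrix k l A) : Matrix k l A := of fun i j => M i j * c j

@[simp] theorem colScale_apply (c : l → A) (M : Matrix k l A) (i : k) (j : l) :
    colScale c M i j = M i j * c j := rfl

theorem mul_colScale [Fintype k] (c : l → A) (M : Matrix m k A) (N : Matrix k l A) :
    M * colScale c N = colScale c (M * N) := by
  ext i j
  simp only [mul_apply, colScale_apply, Finset.sum_mul, mul_assoc]

end Matrix
end

noncomputable section

/-! ### The brackets at one vertex -/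

/-- The sign of `b - a` in a linear order, as an element of a ring. -/
def ordSign (A : Type*) [CommRing A] {ι : Type*} [LinearOrder ι] (a b : ι) : A :=
  if a < b then 1 else if b < a then -1 else 0

section OrdSign

variable {A : Type*} [CommRing A] {ι : Type*} [LinearOrder ι]

theorem ordSign_of_lt {a b : ι} (h : a < b) : ordSign A a b = 1 := by simp [ordSign, h]

theorem ordSign_of_gt {a b : ι} (h : b < a) : ordSign A a b = -1 := by
  simp [ordSign, h, not_lt_of_gt h]

@[simp] theorem ordSign_self (a : ι) : ordSign A a a = 0 := by simp [ordSign]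

end OrdSign

variable {R A : Type*} [CommRing R] [CommRing A] [Algebra R A]
variable {n ι : Type*} [Fintype n] [DecidableEq n] [LinearOrder ι]

/-- Twice the quasi-Poisson brackets between the entries of `T`, the rows of `V` and the columns
of `W` at one vertex. -/
structure VertexRelations (B : A →ₗ[R] A →ₗ[R] A) (T : Matrix n n A) (V : Matrix ι n A)
    (W : Matrix n ι A) : Prop extends IsSkewBiderivation B where
  TT : ∀ i j k l, B (T i j) (T k l) =
    (1 : Matrix n n A) i l * (T * T) k j - (1 : Matrix n n A) k j * (T * T) i l
  TW : ∀ i j k γ, B (T i j) (W k γ) = (1 : Matrix n n A) k j * (T * W) i γ - T k j * W i γ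
  TV : ∀ i j γ l, B (T i j) (V γ l) = (1 : Matrix n n A) i l * (V * T) γ j - V γ j * T i l
  VV : ∀ α j β l, B (V α j) (V β l) = -(ordSign A α β * (V β j * V α l + V α j * V β l))
  WW : ∀ i α k β, B (W i α) (W k β) = -(ordSign A α β * (W k β * W i α + W k α * W i β))
  VW : ∀ α j k β, B (V α j) (W k β) =
    (1 : Matrix ι ι A) α β * (2 * (1 : Matrix n n A) k j + W k β * V α j
      + (1 : Matrix n n A) k j * (V * W) α β)
    + ordSign A α β * ((1 : Matrix n n A) k j * (V * W) α β + W k β * V α j)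


/-! ### The action of one generator on `T`, `V` and `W` -/

namespace VertexRelations

open Matrix

variable {B : A →ₗ[R] A →ₗ[R] A} {T : Matrix n n A} {V : Matrix ι n A} {W : Matrix n ι A}

/-- The generators of the functions at one vertex. -/
inductive Gen (n ι : Type*)
  | T (i j : n)
  | V (α : ι) (j : n)
  | W (i : n) (α : ι)

/-- The matrix entry given by a generator. -/
def Gen.val (T : Matrix n n A) (V : Matrix ι n A) (W : Matrix n ι A) : Gen n ι → A
  | .T i j => T i j
  | .V α j => V α j
  | .W i α => W i α

/-- This form and its analogues below serve to apply Leibniz to words in the matrices: a product of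
a column and a row absorbs multiplication on either side, so no summation index appears. -/
theorem map_T_of_T (h : VertexRelations B T V W) (i j : n) : T.map (h.derivRight (T i j)) =
    colMulRow (T * T) 1 j i - colMulRow 1 (T * T) j i := by
  ext k l
  simp only [map_apply, IsSkewBiderivation.derivRight_apply, h.TT, Matrix.sub_apply,
    colMulRow_apply]
  ring

theorem map_V_of_T (h : VertexRelations B T V W) (i j : n) :
    V.map (h.derivRight (T i j)) =
    colMulRow (V * T) 1 j i - colMulRow V T j i := by
  ext k l
  simp only [map_apply, IsSkewBiderivation.derivRight_apply, h.TV, Matrix.sub_apply,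
    colMulRow_apply]
  ring

theorem map_W_of_T (h : VertexRelations B T V W) (i j : n) :
    W.map (h.derivRight (T i j)) =
    colMulRow 1 (T * W) j i - colMulRow T W j i := by
  ext k l
  simp only [map_apply, IsSkewBiderivation.derivRight_apply, h.TW, Matrix.sub_apply,
    colMulRow_apply]

theorem map_T_of_V (h : VertexRelations B T V W) (α : ι) (j : n) :
    T.map (h.derivRight (V α j)) =
    colMulRow T V j α - colMulRow 1 (V * T) j α := by
  ext k l
  simp only [map_apply, IsSkewBiderivation.derivRight_apply, h.skew (V α j), h.TV, Matrix.sub_apply,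
    colMulRow_apply]
  ring

theorem map_V_of_V (h : VertexRelations B T V W) (α : ι) (j : n) :
    V.map (h.derivRight (V α j)) =
    -rowScale (ordSign A α) (colMulRow V V j α + V α j • V) := by
  ext k l
  simp only [map_apply, IsSkewBiderivation.derivRight_apply, h.VV, Matrix.neg_apply,
    Matrix.add_apply, rowScale_apply, colMulRow_apply, Matrix.smul_apply, smul_eq_mul]

theorem map_W_of_V (h : VertexRelations B T V W) (α : ι) (j : n) :
    W.map (h.derivRight (V α j)) =
    (2 : A) • colMulRow 1 1 j α + colScale
      (fun β => (1 : Matrix ι ι A) α β + ordSign A α β) (colMulRow 1 (V * W) j α + V α j • W) := by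
  ext k l
  simp only [map_apply, IsSkewBiderivation.derivRight_apply, h.VW, Matrix.add_apply, colScale_apply,
    colMulRow_apply, Matrix.smul_apply, smul_eq_mul]
  ring

theorem map_T_of_W (h : VertexRelations B T V W) (i : n) (α : ι) :
    T.map (h.derivRight (W i α)) =
    colMulRow W T α i - colMulRow (T * W) 1 α i := by
  ext k l
  simp only [map_apply, IsSkewBiderivation.derivRight_apply, h.skew (W i α), h.TW, Matrix.sub_apply,
    colMulRow_apply]
  ring

theorem map_V_of_W (h : VertexRelations B T V W) (i : n) (α : ι) :
    V.map (h.derivRight (W i α)) =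
    (-2 : A) • colMulRow 1 1 α i - rowScale
      (fun β => (1 : Matrix ι ι A) β α + ordSign A β α) (colMulRow (V * W) 1 α i + W i α • V) := by
  ext k l
  simp only [map_apply, IsSkewBiderivation.derivRight_apply, h.skew (W i α), h.VW, Matrix.sub_apply,
    rowScale_apply, colMulRow_apply, Matrix.smul_apply, smul_eq_mul, Matrix.add_apply]
  ring

theorem map_W_of_W (h : VertexRelations B T V W) (i : n) (α : ι) :
    W.map (h.derivRight (W i α)) =
    -colScale (ordSign A α) (colMulRow W W α i + W i α • W) := by
  ext k l
  simp only [map_apply, IsSkewBiderivation.derivRight_apply, h.WW, Matrix.neg_apply,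
    Matrix.add_apply, colScale_apply, colMulRow_apply, Matrix.smul_apply, smul_eq_mul]
  ring

/-- The bracket of a function with an entry of a product of matrices. -/
theorem bracket_mul_entry {l m p : Type*} [Fintype m] (h : IsSkewBiderivation B) (F : A)
    (M : Matrix l m A) (N : Matrix m p A) (a : l) (b : p) :
    B F ((M * N) a b) = (M.map (h.derivRight F) * N + M * N.map (h.derivRight F)) a b := by
  rw [← Derivation.map_matrix_mul, map_apply, IsSkewBiderivation.derivRight_apply]


theorem bracket_one {l : Type*} [DecidableEq l] (h : IsSkewBiderivation B) (F : A) (a b : l) :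
    B F ((1 : Matrix l l A) a b) = 0 := by
  rcases eq_or_ne a b with rfl | hab
  · rw [one_apply_eq, h.map_one_right]
  · rw [one_apply_ne hab, map_zero]

theorem bracket_two (h : IsSkewBiderivation B) (F : A) : B F 2 = 0 := by
  rw [← one_add_one_eq_two, map_add, h.map_one_right, add_zero]

theorem bracket_ordSign (h : IsSkewBiderivation B) (F : A) (a b : ι) :
    B F (ordSign A a b) = 0 := by
  rw [ordSign]
  split_ifs
  · exact h.map_one_right F
  · rw [map_neg, h.map_one_right, neg_zero]
  · exact map_zero _

theorem VT (h : VertexRelations B T V W) (α : ι) (j k l : n) : B (V α j) (T k l) =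
    V α l * T k j - (1 : Matrix n n A) k j * (V * T) α l := by
  rw [h.skew, h.TV]; ring

theorem WT (h : VertexRelations B T V W) (i : n) (α : ι) (k l : n) : B (W i α) (T k l) =
    T i l * W k α - (1 : Matrix n n A) i l * (T * W) k α := by
  rw [h.skew, h.TW]; ring

theorem WV (h : VertexRelations B T V W) (i : n) (α β : ι) (l : n) : B (W i α) (V β l) =
    -((1 : Matrix ι ι A) β α * (2 * (1 : Matrix n n A) i l + W i α * V β l
      + (1 : Matrix n n A) i l * (V * W) β α)
    + ordSign A β α * ((1 : Matrix n n A) i l * (V * W) β α + W i α * V β l)) := by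
  rw [h.skew, h.VW]

/-- The matrix of the values on a generator of the infinitesimal changes of basis. -/
def Gen.moment (T : Matrix n n A) (V : Matrix ι n A) (W : Matrix n ι A) :
    Gen n ι → Matrix n n A
  | .T i j => colMulRow 1 T j i - colMulRow T 1 j i
  | .V α j => colMulRow 1 V j α
  | .W i α => -colMulRow W 1 α i

/-- The Cartan trivector on three generators. -/
def cartan (T : Matrix n n A) (V : Matrix ι n A) (W : Matrix n ι A) (x y z : Gen n ι) : A :=
  (x.moment T V W * (y.moment T V W * z.moment T V W - z.moment T V W * y.moment T V W)).trace

/-! ### The Jacobiator on the ten sorted types of triples -/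

theorem jacobiator_TTT (h : VertexRelations B T V W) (i j k l p q : n) :
    jacobiator B (T i j) (T k l) (T p q) =
      cartan T V W (.T i j) (.T k l) (.T p q) := by
  -- Both sides expand to polynomials in entries, at the fixed indices, of words in `T`. No sums
  -- remain, so `ring` decides.
  simp only [jacobiator, h.TT, map_sub, h.leibniz, bracket_mul_entry h.toIsSkewBiderivation,
    h.map_T_of_T, Matrix.sub_mul, Matrix.mul_sub, mul_colMulRow, colMulRow_mul, Matrix.add_apply,
    Matrix.sub_apply, colMulRow_apply, Matrix.one_mul, Matrix.mul_one, Matrix.mul_assoc, bracket_one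
    h.toIsSkewBiderivation, cartan, Gen.moment, trace_sub, trace_colMulRow]
  ring

theorem jacobiator_TTV (h : VertexRelations B T V W) (i j k l p : n) (α : ι) :
    jacobiator B (T i j) (T k l) (V α p) =
      cartan T V W (.T i j) (.T k l) (.V α p) := by
  simp only [jacobiator, h.TT, h.TV, h.VT, map_sub, h.leibniz, bracket_mul_entry
    h.toIsSkewBiderivation, h.map_T_of_T, h.map_V_of_T, h.map_T_of_V, Matrix.sub_mul,
    Matrix.mul_sub, mul_colMulRow, colMulRow_mul, Matrix.add_apply, Matrix.sub_apply,
    colMulRow_apply, Matrix.one_mul, Matrix.mul_one, Matrix.mul_assoc, bracket_one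
    h.toIsSkewBiderivation, cartan, Gen.moment, trace_sub, trace_colMulRow]
  ring

theorem jacobiator_TTW (h : VertexRelations B T V W) (i j k l p : n) (α : ι) :
    jacobiator B (T i j) (T k l) (W p α) =
      cartan T V W (.T i j) (.T k l) (.W p α) := by
  simp only [jacobiator, h.TT, h.TW, h.WT, map_sub, h.leibniz, bracket_mul_entry
    h.toIsSkewBiderivation, h.map_T_of_T, h.map_W_of_T, h.map_T_of_W, Matrix.sub_mul,
    Matrix.mul_sub, Matrix.neg_mul, Matrix.mul_neg, mul_colMulRow, colMulRow_mul, Matrix.add_apply,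
    Matrix.sub_apply, Matrix.neg_apply, colMulRow_apply, Matrix.one_mul, Matrix.mul_one,
    Matrix.mul_assoc, bracket_one h.toIsSkewBiderivation, cartan, Gen.moment, trace_sub, trace_neg,
    trace_colMulRow]
  ring

theorem jacobiator_TVV (h : VertexRelations B T V W) (i j k p : n) (α β : ι) :
    jacobiator B (T i j) (V α k) (V β p) =
      cartan T V W (.T i j) (.V α k) (.V β p) := by
  simp only [jacobiator, h.TV, h.VT, h.VV, map_sub, map_add, map_neg, h.leibniz, bracket_mul_entry
    h.toIsSkewBiderivation, h.map_T_of_V, h.map_V_of_V, Matrix.add_mul, Matrix.mul_sub,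
    Matrix.neg_mul, Matrix.smul_mul, mul_colMulRow, colMulRow_mul, rowScale_mul, Matrix.add_apply,
    Matrix.sub_apply, Matrix.neg_apply, Matrix.smul_apply, smul_eq_mul, colMulRow_apply,
    rowScale_apply, Matrix.mul_one, bracket_one h.toIsSkewBiderivation, bracket_ordSign
    h.toIsSkewBiderivation, cartan, Gen.moment, trace_sub, trace_colMulRow]
  -- Once the order of the spin indices is fixed, every sign is the constant 0, 1 or -1.
  rcases lt_trichotomy α β with hαβ | hαβ | hαβ
  all_goals first
    | order
    | (subst_vars
       simp only [ordSign_self, ordSign_of_lt, ordSign_of_gt, *]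
       ring)

theorem jacobiator_TVW (h : VertexRelations B T V W) (i j k p : n) (α β : ι) :
    jacobiator B (T i j) (V α k) (W p β) =
      cartan T V W (.T i j) (.V α k) (.W p β) := by
  simp only [jacobiator, h.TV, h.TW, h.VT, h.WT, h.VW, h.WV, map_sub, map_add, h.leibniz,
    bracket_mul_entry h.toIsSkewBiderivation, h.map_V_of_T, h.map_W_of_T, h.map_T_of_V,
    h.map_W_of_V, h.map_T_of_W, h.map_V_of_W, Matrix.add_mul, Matrix.mul_add, Matrix.sub_mul,
    Matrix.mul_sub, Matrix.mul_neg, Matrix.smul_mul, Matrix.mul_smul, mul_colMulRow, colMulRow_mul,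
    rowScale_mul, mul_colScale, Matrix.add_apply, Matrix.sub_apply, Matrix.neg_apply,
    Matrix.smul_apply, smul_eq_mul, colMulRow_apply, rowScale_apply, colScale_apply, Matrix.one_mul,
    Matrix.mul_one, Matrix.mul_assoc, bracket_one h.toIsSkewBiderivation, bracket_two
    h.toIsSkewBiderivation, bracket_ordSign h.toIsSkewBiderivation, cartan, Gen.moment, trace_sub,
    trace_neg, trace_colMulRow]
  rcases lt_trichotomy α β with hαβ | hαβ | hαβ
  all_goals first
    | order
    | (subst_vars
       simp only [ordSign_self, one_apply_eq, ordSign_of_lt, ordSign_of_gt, one_apply_ne, ne_eq,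
         LT.lt.ne, LT.lt.ne', not_false_eq_true, *]
       ring)

theorem jacobiator_TWW (h : VertexRelations B T V W) (i j k p : n) (α β : ι) :
    jacobiator B (T i j) (W k α) (W p β) =
      cartan T V W (.T i j) (.W k α) (.W p β) := by
  simp only [jacobiator, h.TW, h.WT, h.WW, map_sub, map_add, map_neg, h.leibniz, bracket_mul_entry
    h.toIsSkewBiderivation, h.map_T_of_W, h.map_W_of_W, Matrix.mul_add, Matrix.sub_mul,
    Matrix.mul_sub, Matrix.neg_mul, Matrix.mul_neg, Matrix.mul_smul, mul_colMulRow, colMulRow_mul,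
    mul_colScale, Matrix.add_apply, Matrix.sub_apply, Matrix.neg_apply, Matrix.smul_apply,
    smul_eq_mul, colMulRow_apply, colScale_apply, Matrix.one_mul, Matrix.mul_one, bracket_one
    h.toIsSkewBiderivation, bracket_ordSign h.toIsSkewBiderivation, cartan, Gen.moment, trace_sub,
    trace_neg, trace_colMulRow]
  rcases lt_trichotomy α β with hαβ | hαβ | hαβ
  all_goals first
    | order
    | (subst_vars
       simp only [ordSign_self, ordSign_of_lt, ordSign_of_gt, *]
       ring)

/-- Two successive brackets of rows produce products of two signs, and these depend only on the
relative order of the three spin indices. The identity is checked for each such order. -/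
theorem jacobiator_VVV (h : VertexRelations B T V W) (i k p : n) (α β γ : ι) :
    jacobiator B (V α i) (V β k) (V γ p) =
      cartan T V W (.V α i) (.V β k) (.V γ p) := by
  simp only [jacobiator, h.VV, map_add, map_neg, h.leibniz, Matrix.mul_sub, mul_colMulRow,
    colMulRow_apply, Matrix.mul_one, bracket_ordSign h.toIsSkewBiderivation, cartan, Gen.moment,
    trace_sub, trace_colMulRow]
  rcases lt_trichotomy α β with hαβ | hαβ | hαβ
  all_goals rcases lt_trichotomy α γ with hαγ | hαγ | hαγ
  all_goals rcases lt_trichotomy β γ with hβγ | hβγ | hβγ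
  -- Of the 27 combinations of comparisons, `order` discards the contradictory ones.
  all_goals first
    | order
    | (subst_vars
       simp only [ordSign_self, ordSign_of_lt, ordSign_of_gt, *]
       ring)

theorem jacobiator_VVW (h : VertexRelations B T V W) (i k p : n) (α β γ : ι) :
    jacobiator B (V α i) (V β k) (W p γ) =
      cartan T V W (.V α i) (.V β k) (.W p γ) := by
  simp only [jacobiator, h.VV, h.VW, h.WV, map_add, map_neg, h.leibniz, bracket_mul_entry
    h.toIsSkewBiderivation, h.map_V_of_V, h.map_W_of_V, Matrix.add_mul, Matrix.mul_add,
    Matrix.mul_sub, Matrix.neg_mul, Matrix.mul_neg, Matrix.smul_mul, Matrix.mul_smul, mul_colMulRow,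
    colMulRow_mul, rowScale_mul, mul_colScale, Matrix.add_apply, Matrix.neg_apply,
    Matrix.smul_apply, smul_eq_mul, colMulRow_apply, rowScale_apply, colScale_apply, Matrix.mul_one,
    bracket_one h.toIsSkewBiderivation, bracket_two h.toIsSkewBiderivation, bracket_ordSign
    h.toIsSkewBiderivation, cartan, Gen.moment, trace_sub, trace_neg, trace_colMulRow]
  rcases lt_trichotomy α β with hαβ | hαβ | hαβ
  all_goals rcases lt_trichotomy α γ with hαγ | hαγ | hαγ
  all_goals rcases lt_trichotomy β γ with hβγ | hβγ | hβγ
  all_goals first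
    | order
    | (subst_vars
       simp only [ordSign_self, one_apply_eq, ordSign_of_lt, ordSign_of_gt, one_apply_ne, ne_eq,
         LT.lt.ne, LT.lt.ne', not_false_eq_true, *]
       ring)

theorem jacobiator_VWW (h : VertexRelations B T V W) (i k p : n) (α β γ : ι) :
    jacobiator B (V α i) (W k β) (W p γ) =
      cartan T V W (.V α i) (.W k β) (.W p γ) := by
  simp only [jacobiator, h.VW, h.WV, h.WW, map_add, map_neg, h.leibniz, bracket_mul_entry
    h.toIsSkewBiderivation, h.map_V_of_W, h.map_W_of_W, Matrix.add_mul, Matrix.mul_add,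
    Matrix.sub_mul, Matrix.mul_sub, Matrix.neg_mul, Matrix.mul_neg, Matrix.smul_mul,
    Matrix.mul_smul, mul_colMulRow, colMulRow_mul, rowScale_mul, mul_colScale, Matrix.add_apply,
    Matrix.sub_apply, Matrix.neg_apply, Matrix.smul_apply, smul_eq_mul, colMulRow_apply,
    rowScale_apply, colScale_apply, Matrix.one_mul, Matrix.mul_one, bracket_one
    h.toIsSkewBiderivation, bracket_two h.toIsSkewBiderivation, bracket_ordSign
    h.toIsSkewBiderivation, cartan, Gen.moment, trace_sub, trace_neg, trace_colMulRow]
  rcases lt_trichotomy α β with hαβ | hαβ | hαβ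
  all_goals rcases lt_trichotomy α γ with hαγ | hαγ | hαγ
  all_goals rcases lt_trichotomy β γ with hβγ | hβγ | hβγ
  all_goals first
    | order
    | (subst_vars
       simp only [ordSign_self, one_apply_eq, ordSign_of_lt, ordSign_of_gt, one_apply_ne, ne_eq,
         LT.lt.ne, LT.lt.ne', not_false_eq_true, *]
       ring)

theorem jacobiator_WWW (h : VertexRelations B T V W) (i k p : n) (α β γ : ι) :
    jacobiator B (W i α) (W k β) (W p γ) =
      cartan T V W (.W i α) (.W k β) (.W p γ) := by
  simp only [jacobiator, h.WW, map_add, map_neg, h.leibniz, Matrix.mul_sub, Matrix.neg_mul,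
    Matrix.mul_neg, mul_colMulRow, colMulRow_mul, Matrix.neg_apply, colMulRow_apply, Matrix.one_mul,
    bracket_ordSign h.toIsSkewBiderivation, cartan, Gen.moment, trace_sub, trace_neg,
    trace_colMulRow]
  rcases lt_trichotomy α β with hαβ | hαβ | hαβ
  all_goals rcases lt_trichotomy α γ with hαγ | hαγ | hαγ
  all_goals rcases lt_trichotomy β γ with hβγ | hβγ | hβγ
  all_goals first
    | order
    | (subst_vars
       simp only [ordSign_self, ordSign_of_lt, ordSign_of_gt, *]
       ring)

end VertexRelations
end

noncomputable section

variable {R A : Type*} [CommRing R] [CommRing A] [Algebra R A]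
variable {n ι : Type*} [Fintype n] [DecidableEq n] [LinearOrder ι]


/-! ### The Jacobi identity for invariant functions at one vertex -/

namespace VertexRelations

open Matrix

variable {B : A →ₗ[R] A →ₗ[R] A} {T : Matrix n n A} {V : Matrix ι n A} {W : Matrix n ι A}

theorem cartan_swap (x y z : Gen n ι) : cartan T V W x z y = -cartan T V W x y z := by
  rw [cartan, cartan, ← trace_neg, ← Matrix.mul_neg, neg_sub]

theorem cartan_rotate (x y z : Gen n ι) : cartan T V W y z x = cartan T V W x y z := by
  have key : ∀ P Q S : Matrix n n A, (P * (Q * S)).trace = (S * (P * Q)).trace := fun P Q S => by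
    rw [← Matrix.mul_assoc, trace_mul_comm]
  simp only [cartan, Matrix.mul_sub, trace_sub]
  rw [key (y.moment T V W), key (y.moment T V W), key (z.moment T V W) (y.moment T V W)]

/-- The kind of a generator. -/
def Gen.kind : Gen n ι → ℕ
  | .T _ _ => 0
  | .V _ _ => 1
  | .W _ _ => 2

theorem jacobiator_sorted (h : VertexRelations B T V W) : ∀ x y z : Gen n ι,
    x.kind ≤ y.kind → y.kind ≤ z.kind →
    jacobiator B (x.val T V W) (y.val T V W) (z.val T V W) = cartan T V W x y z
  | .T _ _, .T _ _, .T _ _, _, _ => h.jacobiator_TTT ..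
  | .T _ _, .T _ _, .V _ _, _, _ => h.jacobiator_TTV ..
  | .T _ _, .T _ _, .W _ _, _, _ => h.jacobiator_TTW ..
  | .T _ _, .V _ _, .V _ _, _, _ => h.jacobiator_TVV ..
  | .T _ _, .V _ _, .W _ _, _, _ => h.jacobiator_TVW ..
  | .T _ _, .W _ _, .W _ _, _, _ => h.jacobiator_TWW ..
  | .V _ _, .V _ _, .V _ _, _, _ => h.jacobiator_VVV ..
  | .V _ _, .V _ _, .W _ _, _, _ => h.jacobiator_VVW ..
  | .V _ _, .W _ _, .W _ _, _, _ => h.jacobiator_VWW ..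
  | .W _ _, .W _ _, .W _ _, _, _ => h.jacobiator_WWW ..

/-- The bracket is quasi-Poisson: its Jacobiator is the Cartan trivector. -/
theorem jacobiator_eq_cartan (h : VertexRelations B T V W) (x y z : Gen n ι) :
    jacobiator B (x.val T V W) (y.val T V W) (z.val T V W) = cartan T V W x y z := by
  have rot : ∀ {x y z : Gen n ι},
      jacobiator B (x.val T V W) (y.val T V W) (z.val T V W) = cartan T V W x y z →
      jacobiator B (y.val T V W) (z.val T V W) (x.val T V W) = cartan T V W y z x := by
    intro x y z hxyz
    rw [jacobiator_rotate, cartan_rotate, hxyz]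
  have swap : ∀ {x y z : Gen n ι},
      jacobiator B (x.val T V W) (y.val T V W) (z.val T V W) = cartan T V W x y z →
      jacobiator B (x.val T V W) (z.val T V W) (y.val T V W) = cartan T V W x z y := by
    intro x y z hxyz
    rw [h.jacobiator_swap, cartan_swap, hxyz]
  -- Both sides are invariant under rotation and change sign under a swap, so each triple is brought
  -- to one sorted by kind.
  rcases le_total x.kind y.kind with hxy | hxy <;> rcases le_total y.kind z.kind with hyz | hyz <;>
    rcases le_total x.kind z.kind with hxz | hxz
  · exact h.jacobiator_sorted _ _ _ hxy hyz
  · exact h.jacobiator_sorted _ _ _ hxy hyz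
  · exact swap (h.jacobiator_sorted _ _ _ hxz hyz)
  · exact rot (h.jacobiator_sorted _ _ _ hxz hxy)
  · exact swap (rot (h.jacobiator_sorted _ _ _ hxy hxz))
  · exact rot (rot (h.jacobiator_sorted _ _ _ hyz hxz))
  · exact swap (rot (rot (h.jacobiator_sorted _ _ _ hyz hxy)))
  · exact swap (rot (rot (h.jacobiator_sorted _ _ _ hyz hxy)))

/-- The algebra generated by the matrix entries at one vertex. -/
def entries (R : Type*) [CommRing R] [Algebra R A] (T : Matrix n n A) (V : Matrix ι n A)
    (W : Matrix n ι A) : Subalgebra R A :=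
  Algebra.adjoin R (Set.range (Gen.val T V W))

theorem val_mem_entries (x : Gen n ι) : x.val T V W ∈ entries R T V W :=
  Algebra.subset_adjoin ⟨x, rfl⟩

theorem pow_apply_mem_entries (k : ℕ) (i j : n) : (T ^ k) i j ∈ entries R T V W := by
  induction k generalizing j with
  | zero =>
    rw [pow_zero, one_apply]
    split_ifs
    exacts [one_mem _, zero_mem _]
  | succ k ih =>
    rw [pow_succ, mul_apply]
    exact sum_mem fun l _ => mul_mem (ih l) (val_mem_entries (.T l j))

theorem spin_mem_entries (k : ℕ) (β α : ι) : (V * T ^ k * W) β α ∈ entries R T V W := by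
  simp only [mul_apply]
  exact sum_mem fun l _ => mul_mem (sum_mem fun l' _ => mul_mem (val_mem_entries (.V β l'))
    (pow_apply_mem_entries k l' l)) (val_mem_entries (.W l α))

/-- The point is that `M` depends on `b` and `c` but not on `x`: as a function of its first
argument, the Jacobiator is then the infinitesimal change of basis by the single matrix `M`, whose
entries are functions. -/
theorem exists_jacobiator_eq_trace (h : VertexRelations B T V W) {b c : A}
    (hb : b ∈ entries R T V W) (hc : c ∈ entries R T V W) : ∃ M : Matrix n n A, ∀ x : Gen n ι,
    jacobiator B (x.val T V W) b c = (x.moment T V W * M).trace := by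
  -- Extends the last argument from generators to the algebra. It is used twice, the middle argument
  -- being reached by a swap.
  have key : ∀ b : A, (∀ y : Gen n ι, ∃ M : Matrix n n A, ∀ x : Gen n ι,
      jacobiator B (x.val T V W) b (y.val T V W) = (x.moment T V W * M).trace) →
      ∀ c ∈ entries R T V W, ∃ M : Matrix n n A, ∀ x : Gen n ι,
      jacobiator B (x.val T V W) b c = (x.moment T V W * M).trace := by
    intro b hgen c hc
    induction hc using Algebra.adjoin_induction with
    | mem c hc =>
      obtain ⟨y, rfl⟩ := hc
      exact hgen y
    | algebraMap r => exact ⟨0, fun x => by simp [h.jacobiator_algebraMap]⟩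
    | add c c' _ _ ih ih' =>
      obtain ⟨M, hM⟩ := ih
      obtain ⟨M', hM'⟩ := ih'
      exact ⟨M + M', fun x => by
        rw [jacobiator_add, hM, hM', Matrix.mul_add, trace_add]⟩
    | mul c c' _ _ ih ih' =>
      obtain ⟨M, hM⟩ := ih
      obtain ⟨M', hM'⟩ := ih'
      -- Leibniz rule for the Jacobiator, carried over to the matrices.
      refine ⟨c' • M + c • M', fun x => ?_⟩
      rw [h.jacobiator_mul, hM, hM', Matrix.mul_add, trace_add, Matrix.mul_smul, Matrix.mul_smul,
        trace_smul, trace_smul, smul_eq_mul, smul_eq_mul, mul_comm c']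
  refine key b (fun y => ?_) c hc
  -- For two generators the matrix, found by unification, is the commutator of their moments.
  obtain ⟨M, hM⟩ := key (y.val T V W) (fun z => ⟨_, fun x => h.jacobiator_eq_cartan x y z⟩) b hb
  exact ⟨-M, fun x => by rw [h.jacobiator_swap, hM, Matrix.mul_neg, trace_neg]⟩

/-- The Jacobi identity for the functions `V T ^ k W`, which are invariant under changes of
basis. -/
theorem jacobiator_spin_eq_zero (h : VertexRelations B T V W) {b c : A}
    (hb : b ∈ entries R T V W) (hc : c ∈ entries R T V W) (k : ℕ) (β α : ι) :
    jacobiator B ((V * T ^ k * W) β α) b c = 0 := by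
  obtain ⟨M, hM⟩ := h.exists_jacobiator_eq_trace hb hc
  have := Derivation.map_matrix_mul_pow_mul_eq_zero (h.derivJacobiator b c) (T := T) (M := M)
    (V := V) (W := W) ?_ ?_ ?_ k
  · exact congrFun (congrFun this β) α
  · ext i j
    refine (hM (.T i j)).trans ?_
    simp [Gen.moment, Matrix.sub_mul, colMulRow_mul, trace_colMulRow]
  · ext α j
    refine (hM (.V α j)).trans ?_
    simp [Gen.moment, colMulRow_mul, trace_colMulRow]
  · ext i α
    refine (hM (.W i α)).trans ?_
    simp [Gen.moment, colMulRow_mul, trace_colMulRow]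

/-! ### Brackets with the powers of `T` -/

/-- Leibniz gives the sum over `a + b = k - 1` of `T ^ (a + 2) ⊗ T ^ b - T ^ a ⊗ T ^ (b + 2)`, which
telescopes in steps of two and leaves two terms at each end. -/
theorem map_pow_of_T (h : VertexRelations B T V W) (i j : n) (k : ℕ) :
    (T ^ k).map (h.derivRight (T i j)) =
      colMulRow (T ^ (k + 1)) 1 j i + colMulRow (T ^ k) T j i - colMulRow T (T ^ k) j i
        - colMulRow 1 (T ^ (k + 1)) j i := by
  induction k with
  | zero => simp [Derivation.map_matrix_one]
  | succ k ih =>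
    rw [pow_succ, Derivation.map_matrix_mul, ih, h.map_T_of_T]
    simp only [Matrix.add_mul, Matrix.sub_mul, Matrix.mul_sub, mul_colMulRow, colMulRow_mul,
      Matrix.one_mul, Matrix.mul_one, pow_succ, Matrix.mul_assoc]
    abel

theorem map_pow_of_V (h : VertexRelations B T V W) (α : ι) (j : n) (k : ℕ) :
    (T ^ k).map (h.derivRight (V α j)) =
      colMulRow (T ^ k) V j α - colMulRow 1 (V * T ^ k) j α := by
  induction k with
  | zero => simp [Derivation.map_matrix_one]
  | succ k ih =>
    rw [pow_succ, Derivation.map_matrix_mul, ih, h.map_T_of_V]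
    simp only [Matrix.sub_mul, Matrix.mul_sub, mul_colMulRow, colMulRow_mul, Matrix.mul_one,
      Matrix.mul_assoc]
    abel

theorem map_pow_of_W (h : VertexRelations B T V W) (i : n) (α : ι) (k : ℕ) :
    (T ^ k).map (h.derivRight (W i α)) =
      colMulRow W (T ^ k) α i - colMulRow (T ^ k * W) 1 α i := by
  induction k with
  | zero => simp [Derivation.map_matrix_one]
  | succ k ih =>
    rw [pow_succ, Derivation.map_matrix_mul, ih, h.map_T_of_W]
    simp only [Matrix.sub_mul, Matrix.mul_sub, mul_colMulRow, colMulRow_mul, Matrix.one_mul,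
      Matrix.mul_assoc]
    abel

end VertexRelations

theorem Derivation.apply_trace {n : Type*} [Fintype n] (D : Derivation R A A) (M : Matrix n n A) :
    D M.trace = (M.map D).trace := by
  simp [Matrix.trace]

namespace VertexRelations

open Matrix

variable {B : A →ₗ[R] A →ₗ[R] A} {T : Matrix n n A} {V : Matrix ι n A} {W : Matrix n ι A}

/-- Under the trace, each of the four boundary terms of the telescoped sum becomes the same entry of
`T ^ (k + 1)`, twice with each sign. -/
theorem bracket_trace_T (h : VertexRelations B T V W) (k : ℕ) (i j : n) :
    B (T ^ k).trace (T i j) = 0 := by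
  rw [h.skew, ← h.derivRight_apply, Derivation.apply_trace, h.map_pow_of_T]
  simp [trace_colMulRow, pow_succ, ← pow_succ']

theorem bracket_trace_V (h : VertexRelations B T V W) (k : ℕ) (α : ι) (j : n) :
    B (T ^ k).trace (V α j) = 0 := by
  rw [h.skew, ← h.derivRight_apply, Derivation.apply_trace, h.map_pow_of_V]
  simp [trace_colMulRow]

theorem bracket_trace_W (h : VertexRelations B T V W) (k : ℕ) (i : n) (α : ι) :
    B (T ^ k).trace (W i α) = 0 := by
  rw [h.skew, ← h.derivRight_apply, Derivation.apply_trace, h.map_pow_of_W]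
  simp [trace_colMulRow]

/-! ### Brackets with the functions `V T ^ k W` -/

theorem map_T_of_spin (h : VertexRelations B T V W) (k : ℕ) (β α : ι) :
    T.map (h.derivRight ((V * T ^ k * W) β α)) =
      (2 : A) • (colMulRow (T ^ (k + 1) * W) V α β - colMulRow (T * W) (V * T ^ k) α β) := by
  ext i j
  simp only [Matrix.map_apply, IsSkewBiderivation.derivRight_apply]
  rw [h.skew, bracket_mul_entry h.toIsSkewBiderivation, Derivation.map_matrix_mul, h.map_pow_of_T,
    h.map_V_of_T, h.map_W_of_T]
  simp only [Matrix.add_mul, Matrix.sub_mul, Matrix.mul_sub, Matrix.mul_add, mul_colMulRow,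
    colMulRow_mul, Matrix.one_mul, Matrix.mul_one, Matrix.add_apply, Matrix.sub_apply,
    Matrix.smul_apply, smul_eq_mul, colMulRow_apply, Matrix.mul_assoc, pow_succ]
  rw [← Matrix.mul_assoc T (T ^ k), ← pow_succ', pow_succ, Matrix.mul_assoc (T ^ k)]
  ring

/-- Each term is a row of `V` or of `V * T ^ k` with a coefficient built from constants and
invariant functions. Multiplying by `T ^ l * W` on the right therefore stays among polynomials in
the invariants. -/
theorem bracket_spin_V (h : VertexRelations B T V W) (k : ℕ) (β α γ : ι) (l : n) :
    B ((V * T ^ k * W) β α) (V γ l) =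
      (ordSign A γ β + 1) * (V * T ^ k * W) γ α * V β l
        - (2 * (1 : Matrix ι ι A) γ α + (1 + (1 : Matrix ι ι A) γ α + ordSign A γ α) *
          (V * W) γ α) * (V * T ^ k) β l
        + (ordSign A γ β - (1 : Matrix ι ι A) γ α - ordSign A γ α) * (V * T ^ k * W) β α * V γ l := by
  rw [h.skew, bracket_mul_entry h.toIsSkewBiderivation, Derivation.map_matrix_mul, h.map_pow_of_V,
    h.map_V_of_V, h.map_W_of_V]
  simp only [Matrix.add_mul, Matrix.sub_mul, Matrix.mul_sub, Matrix.mul_add, mul_colMulRow,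
    colMulRow_mul, Matrix.mul_one, Matrix.add_apply, Matrix.sub_apply, Matrix.smul_apply,
    smul_eq_mul, colMulRow_apply, Matrix.mul_assoc, Matrix.neg_mul, Matrix.neg_apply, rowScale_mul,
    mul_colScale, rowScale_apply, colScale_apply, Matrix.smul_mul, Matrix.mul_smul]
  ring

theorem bracket_spin_W (h : VertexRelations B T V W) (k : ℕ) (β α γ : ι) (i : n) :
    B ((V * T ^ k * W) β α) (W i γ) =
      (2 * (1 : Matrix ι ι A) β γ + ((1 : Matrix ι ι A) β γ + ordSign A β γ - 1) *
          (V * W) β γ) * (T ^ k * W) i α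
        + (1 + ordSign A γ α) * (V * T ^ k * W) β γ * W i α
        + ((1 : Matrix ι ι A) β γ + ordSign A β γ + ordSign A γ α) * (V * T ^ k * W) β α * W i γ := by
  rw [h.skew, bracket_mul_entry h.toIsSkewBiderivation, Derivation.map_matrix_mul, h.map_pow_of_W,
    h.map_V_of_W, h.map_W_of_W]
  simp only [Matrix.add_mul, Matrix.sub_mul, Matrix.mul_sub, Matrix.mul_add, mul_colMulRow,
    colMulRow_mul, Matrix.one_mul, Matrix.add_apply, Matrix.sub_apply, Matrix.smul_apply,
    smul_eq_mul, colMulRow_apply, Matrix.mul_assoc, Matrix.mul_neg, Matrix.neg_apply, rowScale_mul,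
    mul_colScale, rowScale_apply, colScale_apply, Matrix.smul_mul, Matrix.mul_smul]
  ring

end VertexRelations
end

noncomputable section

variable {R A : Type*} [CommRing R] [CommRing A] [Algebra R A]

section OneVertex

variable {n ι : Type*} [Fintype n] [DecidableEq n] [LinearOrder ι]

/-! ### Closure of the functions `V T ^ k W` under the bracket -/

namespace VertexRelations

open Matrix

variable {B : A →ₗ[R] A →ₗ[R] A} {T : Matrix n n A} {V : Matrix ι n A} {W : Matrix n ι A}

theorem ordSign_mem (S : Subalgebra R A) (a b : ι) : ordSign A a b ∈ S := by
  rw [ordSign]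
  split_ifs
  exacts [one_mem S, neg_mem (one_mem S), zero_mem S]

theorem one_apply_mem {ι : Type*} [DecidableEq ι] (S : Subalgebra R A) (a b : ι) :
    (1 : Matrix ι ι A) a b ∈ S := by
  rw [one_apply]
  split_ifs
  exacts [one_mem S, zero_mem S]

/-- The bracket with `T` splits into columns `T ^ a * W` times rows `V * T ^ b`. Between `V * T ^ a`
and `T ^ b * W` each such product breaks into two invariant functions. -/
theorem spin_map_pow_mem (h : VertexRelations B T V W) (S : Subalgebra R A)
    (hS : ∀ (k : ℕ) (β α : ι), (V * T ^ k * W) β α ∈ S) (k : ℕ) (β α : ι) (l a b : ℕ) (γ δ : ι) :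
    (V * T ^ a * (T ^ l).map (h.derivRight ((V * T ^ k * W) β α)) * (T ^ b * W)) γ δ ∈ S := by
  -- The exponent `b` varies because the last factor of `T ^ (l + 1)` is moved into `T ^ b`.
  induction l generalizing b with
  | zero => simp [Derivation.map_matrix_one]
  | succ l ih =>
    rw [pow_succ, Derivation.map_matrix_mul, h.map_T_of_spin, Matrix.mul_add, Matrix.add_mul,
      Matrix.add_apply]
    refine add_mem ?_ ?_
    · have hb := ih (b + 1)
      rw [pow_succ' T b] at hb
      simpa only [Matrix.mul_assoc] using hb
    · simp only [Matrix.mul_smul, Matrix.smul_mul, Matrix.mul_sub, Matrix.sub_mul, mul_colMulRow,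
        colMulRow_mul, Matrix.smul_apply, Matrix.sub_apply, colMulRow_apply, smul_eq_mul]
      have h₁ : V * T ^ a * (T ^ l * (T ^ (k + 1) * W)) = V * T ^ (a + l + (k + 1)) * W := by
        simp only [pow_add, Matrix.mul_assoc]
      have h₂ : V * T ^ a * (T ^ l * (T * W)) = V * T ^ (a + l + 1) * W := by
        simp only [pow_add, pow_one, Matrix.mul_assoc]
      have h₃ : V * T ^ k * (T ^ b * W) = V * T ^ (k + b) * W := by
        simp only [pow_add, Matrix.mul_assoc]
      rw [h₁, h₂, h₃, ← Matrix.mul_assoc V]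
      exact mul_mem (ofNat_mem S 2) (sub_mem (mul_mem (hS _ _ _) (hS _ _ _))
        (mul_mem (hS _ _ _) (hS _ _ _)))

theorem map_V_of_spin_mul_mem (h : VertexRelations B T V W) (S : Subalgebra R A)
    (hS : ∀ (k : ℕ) (β α : ι), (V * T ^ k * W) β α ∈ S) (k : ℕ) (β α : ι) (l : ℕ) (γ δ : ι) :
    (V.map (h.derivRight ((V * T ^ k * W) β α)) * (T ^ l * W)) γ δ ∈ S := by
  have hS₀ : ∀ β α, (V * W) β α ∈ S := fun β α => by simpa using hS 0 β α
  have hk : (V * T ^ k) * (T ^ l * W) = V * T ^ (k + l) * W := by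
    simp only [pow_add, Matrix.mul_assoc]
  -- The formula for the bracket with `V` is linear in its rows, so it may be multiplied by any `N`.
  have key : ∀ N : Matrix n ι A, (V.map (h.derivRight ((V * T ^ k * W) β α)) * N) γ δ =
      (ordSign A γ β + 1) * (V * T ^ k * W) γ α * (V * N) β δ
        - (2 * (1 : Matrix ι ι A) γ α + (1 + (1 : Matrix ι ι A) γ α + ordSign A γ α) *
          (V * W) γ α) * (V * T ^ k * N) β δ
        + (ordSign A γ β - (1 : Matrix ι ι A) γ α - ordSign A γ α) * (V * T ^ k * W) β α *
          (V * N) γ δ := by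
    intro N
    simp only [mul_apply (N := N), Finset.mul_sum, ← Finset.sum_sub_distrib, ←
      Finset.sum_add_distrib]
    refine Finset.sum_congr rfl fun i _ => ?_
    rw [Matrix.map_apply, IsSkewBiderivation.derivRight_apply, h.bracket_spin_V]
    ring
  rw [key, hk, ← Matrix.mul_assoc]
  have ho := ordSign_mem (ι := ι) S
  have h1 := one_apply_mem (ι := ι) S
  exact add_mem (sub_mem (mul_mem (mul_mem (add_mem (ho _ _) (one_mem S)) (hS _ _ _)) (hS _ _ _))
    (mul_mem (add_mem (mul_mem (ofNat_mem S 2) (h1 _ _)) (mul_mem (add_mem (add_mem (one_mem S)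
      (h1 _ _)) (ho _ _)) (hS₀ _ _))) (hS _ _ _)))
    (mul_mem (mul_mem (sub_mem (sub_mem (ho _ _) (h1 _ _)) (ho _ _)) (hS _ _ _)) (hS _ _ _))

theorem mul_map_W_of_spin_mem (h : VertexRelations B T V W) (S : Subalgebra R A)
    (hS : ∀ (k : ℕ) (β α : ι), (V * T ^ k * W) β α ∈ S) (k : ℕ) (β α : ι) (l : ℕ) (δ γ : ι) :
    (V * T ^ l * W.map (h.derivRight ((V * T ^ k * W) β α))) δ γ ∈ S := by
  have hS₀ : ∀ β α, (V * W) β α ∈ S := fun β α => by simpa using hS 0 β α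
  have hk : (V * T ^ l) * (T ^ k * W) = V * T ^ (l + k) * W := by
    simp only [pow_add, Matrix.mul_assoc]
  have key : ∀ N : Matrix ι n A, (N * W.map (h.derivRight ((V * T ^ k * W) β α))) δ γ =
      (2 * (1 : Matrix ι ι A) β γ + ((1 : Matrix ι ι A) β γ + ordSign A β γ - 1) *
          (V * W) β γ) * (N * (T ^ k * W)) δ α
        + (1 + ordSign A γ α) * (V * T ^ k * W) β γ * (N * W) δ α
        + ((1 : Matrix ι ι A) β γ + ordSign A β γ + ordSign A γ α) * (V * T ^ k * W) β α *
          (N * W) δ γ := by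
    intro N
    simp only [mul_apply (M := N), Finset.mul_sum, ← Finset.sum_add_distrib]
    refine Finset.sum_congr rfl fun i _ => ?_
    rw [Matrix.map_apply, IsSkewBiderivation.derivRight_apply, h.bracket_spin_W]
    ring
  rw [key, hk]
  have ho := ordSign_mem (ι := ι) S
  have h1 := one_apply_mem (ι := ι) S
  exact add_mem (add_mem (mul_mem (add_mem (mul_mem (ofNat_mem S 2) (h1 _ _)) (mul_mem
      (sub_mem (add_mem (h1 _ _) (ho _ _)) (one_mem S)) (hS₀ _ _))) (hS _ _ _))
    (mul_mem (mul_mem (add_mem (one_mem S) (ho _ _)) (hS _ _ _)) (hS _ _ _)))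
    (mul_mem (mul_mem (add_mem (add_mem (h1 _ _) (ho _ _)) (ho _ _)) (hS _ _ _)) (hS _ _ _))

/-- The functions `V T ^ k W` generate a subalgebra closed under the bracket. -/
theorem bracket_spin_spin_mem (h : VertexRelations B T V W) (S : Subalgebra R A)
    (hS : ∀ (k : ℕ) (β α : ι), (V * T ^ k * W) β α ∈ S) (k : ℕ) (β α : ι) (l : ℕ) (γ δ : ι) :
    B ((V * T ^ k * W) β α) ((V * T ^ l * W) γ δ) ∈ S := by
  rw [bracket_mul_entry h.toIsSkewBiderivation, Derivation.map_matrix_mul, Matrix.add_mul,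
    Matrix.add_apply, Matrix.add_apply]
  refine add_mem (add_mem ?_ ?_) (h.mul_map_W_of_spin_mem S hS k β α l γ δ)
  · rw [Matrix.mul_assoc]
    exact h.map_V_of_spin_mul_mem S hS k β α l γ δ
  · simpa using h.spin_map_pow_mem S hS k β α l 0 0 γ δ

end VertexRelations

/-! ### Criteria for commuting with invariant functions -/

namespace IsSkewBiderivation

open Matrix VertexRelations

variable {B : A →ₗ[R] A →ₗ[R] A}

/-- A function that commutes with a set commutes with the algebra generated by it. -/
theorem bracket_adjoin_right_eq_zero (hB : IsSkewBiderivation B) {s : Set A} {F : A}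
    (h : ∀ G ∈ s, B F G = 0) {G : A} (hG : G ∈ Algebra.adjoin R s) : B F G = 0 := by
  induction hG using Algebra.adjoin_induction with
  | mem G hG => exact h G hG
  | algebraMap r => exact hB.map_algebraMap_right F r
  | add G G' _ _ ih ih' => rw [map_add, ih, ih', add_zero]
  | mul G G' _ _ ih ih' => rw [hB.leibniz, ih, ih', zero_mul, mul_zero, add_zero]

theorem bracket_trace_pow_eq_zero (hB : IsSkewBiderivation B) {T : Matrix n n A} {F : A}
    (h : ∀ i j, B F (T i j) = 0) (k : ℕ) : B F (T ^ k).trace = 0 := by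
  have hT : T.map (hB.derivRight F) = T * 0 - 0 * T := by
    ext i j
    simpa using h i j
  rw [← hB.derivRight_apply, Derivation.apply_trace, Derivation.map_matrix_pow_of_commutator _ hT]
  simp

/-- A function commutes with `V T ^ k W` if it commutes with `T` and rescales the rows of `V` and
the columns of `W` by opposite factors. -/
theorem bracket_spin_eq_zero {ι κ : Type*} (hB : IsSkewBiderivation B) {T : Matrix n n A}
    {V : Matrix ι n A} {W : Matrix n κ A} {F c : A} (hT : ∀ i j, B F (T i j) = 0)
    (hV : ∀ α j, B F (V α j) = c * V α j) (hW : ∀ i α, B F (W i α) = -(c * W i α)) (k : ℕ)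
    (β : ι) (α : κ) : B F ((V * T ^ k * W) β α) = 0 := by
  -- A rescaling is a change of basis by the scalar matrix `c`, which commutes with `T`. The factor
  -- `c` may itself be a function.
  have := Derivation.map_matrix_mul_pow_mul_eq_zero (hB.derivRight F) (T := T) (V := V) (W := W)
    (M := scalar n c) ?_ ?_ ?_ k
  · exact congrFun (congrFun this β) α
  · ext i j
    simp [hT, mul_comm]
  · ext α j
    simp [hV, mul_comm]
  · ext i α
    simp [hW]

end IsSkewBiderivation

end OneVertex

/-! ### Several vertices -/

section ManyVertices

/-- Twice the quasi-Poisson brackets between the matrices at several vertices. -/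
structure QuiverRelations {σ : Type*} {n ι : σ → Type*} [∀ s, Fintype (n s)]
    [∀ s, DecidableEq (n s)] [∀ s, LinearOrder (ι s)] (B : A →ₗ[R] A →ₗ[R] A)
    (T : ∀ s, Matrix (n s) (n s) A) (V : ∀ s, Matrix (ι s) (n s) A)
    (W : ∀ s, Matrix (n s) (ι s) A) (o : σ → σ → A) : Prop extends IsSkewBiderivation B where
  vertex : ∀ s, VertexRelations B (T s) (V s) (W s)
  TT : ∀ s r, s ≠ r → ∀ i j k l, B (T s i j) (T r k l) = 0
  TV : ∀ s r, s ≠ r → ∀ i j α k, B (T s i j) (V r α k) = 0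
  TW : ∀ s r, s ≠ r → ∀ i j k α, B (T s i j) (W r k α) = 0
  VV : ∀ s r, s ≠ r → ∀ α j β l, B (V s α j) (V r β l) = -(o s r * V s α j * V r β l)
  VW : ∀ s r, s ≠ r → ∀ α j k β, B (V s α j) (W r k β) = o s r * V s α j * W r k β
  WW : ∀ s r, s ≠ r → ∀ i α k β, B (W s i α) (W r k β) = -(o s r * W s i α * W r k β)
  o_swap : ∀ s r, o r s = -o s r

namespace QuiverRelations

variable {σ : Type*} {n ι : σ → Type*} [∀ s, Fintype (n s)]
    [∀ s, DecidableEq (n s)] [∀ s, LinearOrder (ι s)] {B : A →ₗ[R] A →ₗ[R] A}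
    {T : ∀ s, Matrix (n s) (n s) A} {V : ∀ s, Matrix (ι s) (n s) A}
    {W : ∀ s, Matrix (n s) (ι s) A} {o : σ → σ → A}

theorem bracket_trace_T (h : QuiverRelations B T V W o) (s r : σ) (k : ℕ) (i j : n r) :
    B (T s ^ k).trace (T r i j) = 0 := by
  rcases eq_or_ne s r with rfl | hsr
  · exact (h.vertex s).bracket_trace_T k i j
  · rw [h.skew, h.bracket_trace_pow_eq_zero (fun i' j' => h.TT r s hsr.symm ..), neg_zero]

theorem bracket_trace_V (h : QuiverRelations B T V W o) (s r : σ) (k : ℕ) (α : ι r) (j : n r) :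
    B (T s ^ k).trace (V r α j) = 0 := by
  rcases eq_or_ne s r with rfl | hsr
  · exact (h.vertex s).bracket_trace_V k α j
  · rw [h.skew, h.bracket_trace_pow_eq_zero (fun i' j' => ?_), neg_zero]
    rw [h.skew, h.TV s r hsr, neg_zero]

theorem bracket_trace_W (h : QuiverRelations B T V W o) (s r : σ) (k : ℕ) (i : n r) (α : ι r) :
    B (T s ^ k).trace (W r i α) = 0 := by
  rcases eq_or_ne s r with rfl | hsr
  · exact (h.vertex s).bracket_trace_W k i α
  · rw [h.skew, h.bracket_trace_pow_eq_zero (fun i' j' => ?_), neg_zero]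
    rw [h.skew, h.TW s r hsr, neg_zero]

theorem bracket_trace_trace (h : QuiverRelations B T V W o) (s r : σ) (k l : ℕ) :
    B (T s ^ k).trace (T r ^ l).trace = 0 :=
  h.bracket_trace_pow_eq_zero (h.bracket_trace_T s r k) l

theorem bracket_trace_spin (h : QuiverRelations B T V W o) (s r : σ) (k l : ℕ) (β α : ι r) :
    B (T s ^ k).trace ((V r * T r ^ l * W r) β α) = 0 :=
  h.bracket_spin_eq_zero (c := 0) (h.bracket_trace_T s r k)
    (fun α j => by rw [h.bracket_trace_V, zero_mul])
    (fun i α => by rw [h.bracket_trace_W, zero_mul, neg_zero]) l β α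

/-- The function at `s` commutes with each entry of `T r`, `V r` and `W r` separately: such an entry
scales the rows of `V s` and the columns of `W s` by opposite factors, possibly zero. -/
theorem bracket_spin_spin_of_ne (h : QuiverRelations B T V W o) {s r : σ} (hsr : s ≠ r) (k l : ℕ)
    (β α : ι s) (δ γ : ι r) : B ((V s * T s ^ k * W s) β α) ((V r * T r ^ l * W r) δ γ) = 0 := by
  refine h.bracket_spin_eq_zero (c := 0) (fun i j => ?_) (fun ε j => ?_) (fun i ε => ?_) l δ γ
  · rw [h.skew, h.bracket_spin_eq_zero (c := 0) (fun i' j' => h.TT r s hsr.symm ..)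
      (fun α' j' => by rw [h.TV r s hsr.symm, zero_mul])
      (fun i' α' => by rw [h.TW r s hsr.symm, zero_mul, neg_zero]), neg_zero]
  -- The factor is read off from the relation `VV`; `VW` gives the opposite one.
  · rw [h.skew, h.bracket_spin_eq_zero (c := -(o r s * V r ε j))
      (fun i' j' => by rw [h.skew, h.TV s r hsr, neg_zero])
      (fun α' j' => by rw [h.VV r s hsr.symm]; ring)
      (fun i' α' => by rw [h.VW r s hsr.symm]; ring), neg_zero, zero_mul]
  · rw [h.skew, h.bracket_spin_eq_zero (c := o r s * W r i ε)
      (fun i' j' => by rw [h.skew, h.TW s r hsr, neg_zero])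
      (fun α' j' => by rw [h.skew, h.VW s r hsr, h.o_swap s r]; ring)
      (fun i' α' => by rw [h.WW r s hsr.symm]), neg_zero, zero_mul, neg_zero]

/-- The functions `tr (T ^ k)`. -/
def traces (T : ∀ s, Matrix (n s) (n s) A) : Set A := {F | ∃ (s : σ) (k : ℕ), F = (T s ^ k).trace}

/-- The functions `V T ^ k W` at one vertex. -/
def spins (T : ∀ s, Matrix (n s) (n s) A) (V : ∀ s, Matrix (ι s) (n s) A)
    (W : ∀ s, Matrix (n s) (ι s) A) (s : σ) : Set A :=
  {F | ∃ (k : ℕ) (β α : ι s), F = (V s * T s ^ k * W s) β α}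

/-- The functions `tr (T ^ k)` and `V T ^ k W`. -/
def invariants (T : ∀ s, Matrix (n s) (n s) A) (V : ∀ s, Matrix (ι s) (n s) A)
    (W : ∀ s, Matrix (n s) (ι s) A) : Set A :=
  traces T ∪ ⋃ s, spins T V W s

theorem bracket_trace_adjoin (h : QuiverRelations B T V W o) {F G : A} (hF : F ∈ traces T)
    (hG : G ∈ Algebra.adjoin R (invariants T V W)) : B F G = 0 := by
  refine h.bracket_adjoin_right_eq_zero ?_ hG
  obtain ⟨s, k, rfl⟩ := hF
  rintro G (⟨r, l, rfl⟩ | hG)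
  · exact h.bracket_trace_trace ..
  · obtain ⟨r, l, β, α, rfl⟩ := Set.mem_iUnion.1 hG
    exact h.bracket_trace_spin ..

theorem bracket_spins_mem (h : QuiverRelations B T V W o) {s : σ} {F G : A}
    (hF : F ∈ spins T V W s) (hG : G ∈ spins T V W s) :
    B F G ∈ Algebra.adjoin R (spins T V W s) := by
  obtain ⟨k, β, α, rfl⟩ := hF
  obtain ⟨l, δ, γ, rfl⟩ := hG
  have hS : ∀ (k : ℕ) (β α : ι s), (V s * T s ^ k * W s) β α ∈
      Algebra.adjoin R (spins T V W s) :=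
    fun k β α => Algebra.subset_adjoin ⟨k, β, α, rfl⟩
  exact (h.vertex s).bracket_spin_spin_mem _ hS k β α l δ γ

theorem bracket_spins_of_ne (h : QuiverRelations B T V W o) {s r : σ} (hsr : s ≠ r) {F G : A}
    (hF : F ∈ spins T V W s) (hG : G ∈ Algebra.adjoin R (spins T V W r)) : B F G = 0 := by
  refine h.bracket_adjoin_right_eq_zero ?_ hG
  obtain ⟨k, β, α, rfl⟩ := hF
  rintro G ⟨l, δ, γ, rfl⟩
  exact h.bracket_spin_spin_of_ne hsr ..

theorem bracket_invariants_mem (h : QuiverRelations B T V W o) {F G : A}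
    (hF : F ∈ invariants T V W) (hG : G ∈ invariants T V W) :
    B F G ∈ Algebra.adjoin R (invariants T V W) := by
  rcases hF with hF | hF'
  · rw [h.bracket_trace_adjoin hF (Algebra.subset_adjoin hG)]
    exact zero_mem _
  rcases hG with hG | hG
  · rw [h.skew, h.bracket_trace_adjoin hG (Algebra.subset_adjoin (.inr hF')), neg_zero]
    exact zero_mem _
  obtain ⟨s, hs⟩ := Set.mem_iUnion.1 hF'
  obtain ⟨r, hr⟩ := Set.mem_iUnion.1 hG
  rcases eq_or_ne s r with rfl | hsr
  · exact Algebra.adjoin_mono (fun x hx => .inr (Set.mem_iUnion.2 ⟨s, hx⟩))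
      (h.bracket_spins_mem hs hr)
  · rw [h.bracket_spins_of_ne hsr hs (Algebra.subset_adjoin hr)]
    exact zero_mem _

/-- Two inner brackets contain the central `F`. In the third term `F` is bracketed with `B G H`,
which lies in the algebra by closure. -/
theorem jacobiator_trace (h : QuiverRelations B T V W o) {F G H : A} (hF : F ∈ traces T)
    (hG : G ∈ invariants T V W) (hH : H ∈ invariants T V W) : jacobiator B F G H = 0 := by
  rw [jacobiator, h.bracket_trace_adjoin hF (h.bracket_invariants_mem hG hH), h.skew H F,
    h.bracket_trace_adjoin hF (Algebra.subset_adjoin hG),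
    h.bracket_trace_adjoin hF (Algebra.subset_adjoin hH)]
  simp

/-- `F` commutes with `G` and `H`. It also commutes with `B G H`, which is zero if `r ≠ q` and
otherwise lies in the algebra of the vertex `r`, different from `s`. -/
theorem jacobiator_spins_of_ne (h : QuiverRelations B T V W o) {s r q : σ} (hsr : s ≠ r)
    (hsq : s ≠ q) {F G H : A} (hF : F ∈ spins T V W s) (hG : G ∈ spins T V W r)
    (hH : H ∈ spins T V W q) : jacobiator B F G H = 0 := by
  have hGH : B F (B G H) = 0 := by
    rcases eq_or_ne r q with rfl | hrq
    · exact h.bracket_spins_of_ne hsr hF (h.bracket_spins_mem hG hH)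
    · rw [h.bracket_spins_of_ne hrq hG (Algebra.subset_adjoin hH), map_zero]
  rw [jacobiator, hGH, h.skew H F, h.bracket_spins_of_ne hsr hF (Algebra.subset_adjoin hG),
    h.bracket_spins_of_ne hsq hF (Algebra.subset_adjoin hH)]
  simp

theorem jacobiator_invariants (h : QuiverRelations B T V W o) {F G H : A}
    (hF : F ∈ invariants T V W) (hG : G ∈ invariants T V W) (hH : H ∈ invariants T V W) :
    jacobiator B F G H = 0 := by
  by_cases hF' : F ∈ traces T
  · exact h.jacobiator_trace hF' hG hH
  by_cases hG' : G ∈ traces T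
  · rw [← jacobiator_rotate]
    exact h.jacobiator_trace hG' hH hF
  by_cases hH' : H ∈ traces T
  · rw [← jacobiator_rotate, ← jacobiator_rotate]
    exact h.jacobiator_trace hH' hF hG
  obtain ⟨s, hs⟩ := Set.mem_iUnion.1 (hF.resolve_left hF')
  obtain ⟨r, hr⟩ := Set.mem_iUnion.1 (hG.resolve_left hG')
  obtain ⟨q, hq⟩ := Set.mem_iUnion.1 (hH.resolve_left hH')
  -- Unless the three vertices coincide, one of them differs from both others; a rotation puts it
  -- first.
  rcases eq_or_ne s r with rfl | hsr
  · rcases eq_or_ne s q with rfl | hsq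
    · obtain ⟨k, β, α, rfl⟩ := hs
      obtain ⟨l, δ, γ, rfl⟩ := hr
      obtain ⟨p, ζ, ε, rfl⟩ := hq
      exact (h.vertex s).jacobiator_spin_eq_zero (VertexRelations.spin_mem_entries l δ γ)
        (VertexRelations.spin_mem_entries p ζ ε) k β α
    · rw [← jacobiator_rotate, ← jacobiator_rotate]
      exact h.jacobiator_spins_of_ne hsq.symm hsq.symm hq hs hr
  · rcases eq_or_ne s q with rfl | hsq
    · rw [← jacobiator_rotate]
      exact h.jacobiator_spins_of_ne hsr.symm hsr.symm hr hq hs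
    · exact h.jacobiator_spins_of_ne hsr hsq hs hr hq

end QuiverRelations

end ManyVertices

/-! ### Poisson subalgebras -/

namespace IsSkewBiderivation

variable {B : A →ₗ[R] A →ₗ[R] A}

theorem bracket_mem_adjoin (hB : IsSkewBiderivation B) {s : Set A}
    (h : ∀ F ∈ s, ∀ G ∈ s, B F G ∈ Algebra.adjoin R s) {F G : A} (hF : F ∈ Algebra.adjoin R s)
    (hG : G ∈ Algebra.adjoin R s) : B F G ∈ Algebra.adjoin R s := by
  have key : ∀ F, (∀ G ∈ s, B F G ∈ Algebra.adjoin R s) → ∀ G ∈ Algebra.adjoin R s,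
      B F G ∈ Algebra.adjoin R s := by
    intro F hF G hG
    induction hG using Algebra.adjoin_induction with
    | mem G hG => exact hF G hG
    | algebraMap r =>
      rw [hB.map_algebraMap_right]
      exact zero_mem _
    | add G G' _ _ ih ih' =>
      rw [map_add]
      exact add_mem ih ih'
    | mul G G' hG hG' ih ih' =>
      rw [hB.leibniz]
      exact add_mem (mul_mem ih hG') (mul_mem hG ih')
  refine key F (fun G hG => ?_) G hG
  rw [hB.skew]
  exact neg_mem (key G (h G hG) F hF)

theorem jacobiator_adjoin_eq_zero (hB : IsSkewBiderivation B) {s : Set A}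
    (h : ∀ F ∈ s, ∀ G ∈ s, ∀ H ∈ s, jacobiator B F G H = 0) {F G H : A}
    (hF : F ∈ Algebra.adjoin R s) (hG : G ∈ Algebra.adjoin R s) (hH : H ∈ Algebra.adjoin R s) :
    jacobiator B F G H = 0 := by
  have key : ∀ F G, (∀ H ∈ s, jacobiator B F G H = 0) → ∀ H ∈ Algebra.adjoin R s,
      jacobiator B F G H = 0 := by
    intro F G hFG H hH
    induction hH using Algebra.adjoin_induction with
    | mem H hH => exact hFG H hH
    | algebraMap r => exact hB.jacobiator_algebraMap F G r
    | add H H' _ _ ih ih' => rw [jacobiator_add, ih, ih', add_zero]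
    | mul H H' _ _ ih ih' => rw [hB.jacobiator_mul, ih, ih', zero_mul, mul_zero, add_zero]
  -- `key` treats the last slot only, and two rotations bring each argument there in turn.
  refine key F G (fun H hH => ?_) H hH
  rw [← jacobiator_rotate, ← jacobiator_rotate]
  refine key H F (fun G hG => ?_) G hG
  rw [← jacobiator_rotate, ← jacobiator_rotate]
  refine key G H (fun F hF => ?_) F hF
  rw [← jacobiator_rotate, ← jacobiator_rotate]
  exact h F hF G hG H hH

end IsSkewBiderivation

theorem IsSkewBiderivation.isPoissonSubalgebra_adjoin {A : Type*} [CommRing A] [Algebra ℂ A]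
    {B : A →ₗ[ℂ] A →ₗ[ℂ] A} (hB : IsSkewBiderivation B) {s : Set A}
    (hs : ∀ F ∈ s, ∀ G ∈ s, B F G ∈ Algebra.adjoin ℂ s)
    (hJ : ∀ F ∈ s, ∀ G ∈ s, ∀ H ∈ s, jacobiator B F G H = 0) :
    IsPoissonSubalgebra B (Algebra.adjoin ℂ s) where
  closed _ hF _ hG := hB.bracket_mem_adjoin hs hF hG
  skew _ _ _ _ := hB.skew ..
  leibniz _ _ _ _ _ _ := hB.leibniz ..
  jacobi _ hF _ hG _ hH := hB.jacobiator_adjoin_eq_zero hJ hF hG hH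
end

noncomputable section

namespace CyclicQuiver

open Matrix

/-! ### Blocks -/

section Blocks

variable {m : ℕ} {n : ZMod m → ℕ} {R : Type*} [CommRing R]

theorem sum_incl {ι : Type*} [Fintype ι] [DecidableEq ι] (i : ι) (f : ι → R) :
    ∑ j, (if j = i then 1 else 0) * f j = f i := by simp

theorem block_apply {s t : ZMod m} (M : Matrix (Fin (n s)) (Fin (n t)) R) (i : Fin (n s))
    (j : Fin (n t)) : block M ⟨s, i⟩ ⟨t, j⟩ = M i j := by
  simp [block, incl, mul_apply]

theorem incl_mulVec_apply (s : ZMod m) (v : Fin (n s) → R) (i : Fin (n s)) :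
    (incl R n s *ᵥ v) ⟨s, i⟩ = v i := by
  simp [incl, mulVec, dotProduct]

variable [NeZero m]

theorem incl_transpose_mul_incl (s : ZMod m) : (incl R n s)ᵀ * incl R n s = 1 := by
  ext i j
  simp [incl, mul_apply, one_apply, eq_comm]

theorem incl_transpose_mul_incl_of_ne {s t : ZMod m} (hst : s ≠ t) :
    (incl R n s)ᵀ * incl R n t = 0 := by
  ext i j
  simp only [incl, mul_apply, transpose_apply, of_apply, Matrix.zero_apply]
  rw [sum_incl]
  simp [hst]

theorem block_mul_block {s t u : ZMod m} (M : Matrix (Fin (n s)) (Fin (n t)) R)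
    (N : Matrix (Fin (n t)) (Fin (n u)) R) : block M * block N = block (M * N) := by
  have h := incl_transpose_mul_incl (R := R) (n := n) t
  simp only [block, Matrix.mul_assoc]
  rw [← Matrix.mul_assoc (incl R n t)ᵀ, h, Matrix.one_mul]

theorem mul_block_apply {ι : Type*} {s t : ZMod m} (P : Matrix ι (Idx m n) R)
    (M : Matrix (Fin (n s)) (Fin (n t)) R) (i : ι) (j : Fin (n t)) :
    (P * block M) i ⟨t, j⟩ = ∑ a, P i ⟨s, a⟩ * M a j := by
  rw [block, ← Matrix.mul_assoc, ← Matrix.mul_assoc]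
  simp [incl, mul_apply]

theorem block_mul_apply {ι : Type*} {s t : ZMod m} (P : Matrix (Idx m n) ι R)
    (M : Matrix (Fin (n s)) (Fin (n t)) R) (i : Fin (n s)) (j : ι) :
    (block M * P) ⟨s, i⟩ j = ∑ a, M i a * P ⟨t, a⟩ j := by
  rw [block, Matrix.mul_assoc, Matrix.mul_assoc]
  simp [incl, mul_apply]

end Blocks

/-! ### The traces at a vertex -/

section Traces

variable {m : ℕ} [NeZero m] {d n : ZMod m → ℕ} {R : Type*} [CommRing R] (x : Coord m d n → R)

/-- The rows `V_{s,α}` at the vertex `s`, as the rows of a matrix. -/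
def Vmat (s : ZMod m) : Matrix (Fin (d s)) (Fin (n s)) R := .of fun α j => x (.V s α j)

/-- The columns `W_{s,α}` at the vertex `s`, as the columns of a matrix. -/
def Wmat (s : ZMod m) : Matrix (Fin (n s)) (Fin (d s)) R := .of fun i α => x (.W s α i)

/-- Isolates the products `(incl q)ᵀ * incl s` and `(incl s)ᵀ * incl p`, which are the identity or
zero according to whether the vertices agree. -/
theorem traceWVT_eq (p : ZMod m) (α : Fin (d p)) (q : ZMod m) (β : Fin (d q)) (s : ZMod m)
    (k : ℕ) : traceWVT x p α q β s k =
      (Vrow x q β ᵥ* ((incl R n q)ᵀ * incl R n s)) ᵥ* (Tmat x s ^ k) ⬝ᵥ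
        (((incl R n s)ᵀ * incl R n p) *ᵥ Wcol x p α) := by
  rw [traceWVT, vecMulVec_mul, trace_vecMulVec, block, Vcyc, Wcyc, dotProduct_comm,
    ← vecMul_transpose]
  simp only [vecMul_vecMul, dotProduct_mulVec, Matrix.mul_assoc]

theorem traceWVT_self (s : ZMod m) (α β : Fin (d s)) (k : ℕ) :
    traceWVT x s α s β s k = (Vmat x s * Tmat x s ^ k * Wmat x s) β α := by
  rw [traceWVT_eq, incl_transpose_mul_incl, vecMul_one, one_mulVec]
  rfl

theorem traceWVT_eq_zero {p q s : ZMod m} (h : ¬(p = s ∧ q = s)) (α : Fin (d p)) (β : Fin (d q))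
    (k : ℕ) : traceWVT x p α q β s k = 0 := by
  rw [traceWVT_eq]
  by_cases hq : q = s
  · rw [incl_transpose_mul_incl_of_ne (s := s) (t := p) (fun hp => h ⟨hp.symm, hq⟩), zero_mulVec,
      dotProduct_zero]
  · rw [incl_transpose_mul_incl_of_ne hq, vecMul_zero, zero_vecMul, zero_dotProduct]

end Traces

/-! ### The bracket is a skew-symmetric biderivation -/

section Bracket

variable {m : ℕ} [NeZero m] (d n : ZMod m → ℕ)

theorem delta_comm {ι : Type*} [DecidableEq ι] (i j : ι) : delta i j = delta j i := by
  simp only [delta, eq_comm]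

theorem delta_sub_one {m : ℕ} (r s : ZMod m) : delta s (r - 1) = delta r (s + 1) := by
  simp only [delta, eq_sub_iff_add_eq, eq_comm]

/-- Under a vertex delta it permits replacing `r - 1` or `r + 1` by `s` inside matrices on `𝒱_cyc`,
with no transport between index types. -/
theorem delta_smul_congr {ι M : Type*} [DecidableEq ι] [AddCommGroup M] [Module ℂ M] {i j : ι}
    {x y : M} (h : i = j → x = y) : delta i j • x = delta i j • y := by
  by_cases hij : i = j
  · rw [h hij]
  · simp [delta, hij]

theorem ordZ_swap (s r : ZMod m) : ordZ r s = -ordZ s r := by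
  simp only [ordZ]
  rw [← neg_sub, Left.sign_neg]
  simp

theorem ordF_swap {a b : ℕ} (α : Fin a) (β : Fin b) : ordF β α = -ordF α β := by
  simp only [ordF]
  rw [← neg_sub, Left.sign_neg]
  simp

/-- The scalar `δ_{s,t}` as a regular function. -/
def cdelta (s t : ZMod m) : Reg d n := algebraMap ℂ (Reg d n) (delta s t)

theorem delta_smul (i j : Idx m n) (x : Reg d n) :
    delta i j • x = (1 : Matrix (Idx m n) (Idx m n) (Reg d n)) i j * x := by
  by_cases h : i = j
  · rw [h, delta, if_pos rfl, one_apply_eq, one_smul, one_mul]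
  · rw [delta, if_neg h, one_apply_ne h, zero_smul, zero_mul]

theorem delta_smul_vertex (s t : ZMod m) (x : Reg d n) : delta s t • x = cdelta d n s t * x := by
  rw [cdelta, Algebra.smul_def]

local notation "𝐗" => Xcyc (coord d n)
local notation "𝐘" => Ycyc (coord d n)
local notation "𝟏" => (1 : Matrix (Idx m n) (Idx m n) (Reg d n))

theorem cdelta_comm (s t : ZMod m) : cdelta d n s t = cdelta d n t s := by
  rw [cdelta, delta_comm, cdelta]

theorem two_smul_half_mul_smul (c : ℂ) (x : Reg d n) : (2 : ℂ) • (1 / 2 * c) • x = c • x := by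
  rw [smul_smul, ← mul_assoc]
  norm_num

/-- Only `r` and `s` occur inside the matrices on the right. In this form skew-symmetry is a `ring`
identity, and the products with `X_s` and `Y_s` taken later can be matched term by term. -/
theorem two_brXX (r s : ZMod m) (i j k l : Idx m n) : (2 : ℂ) • brXX d n r s i j k l =
    cdelta d n r (s + 1) * ((𝐗 s * 𝐗 r) k j * 𝟏 i l)
      - cdelta d n s (r + 1) * (𝟏 k j * (𝐗 r * 𝐗 s) i l) := by
  have h₁ : delta r (s + 1) • (𝐗 (r - 1) * 𝐗 r) k j = delta r (s + 1) • (𝐗 s * 𝐗 r) k j :=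
    delta_smul_congr fun h => by rw [h, add_sub_cancel_right]
  have h₂ : delta s (r + 1) • (𝐗 r * 𝐗 (r + 1)) i l = delta s (r + 1) • (𝐗 r * 𝐗 s) i l :=
    delta_smul_congr fun h => by rw [h]
  rw [delta_smul_vertex, delta_smul_vertex] at h₁ h₂
  rw [brXX, delta_sub_one, smul_sub, mul_assoc, mul_assoc, two_smul_half_mul_smul,
    two_smul_half_mul_smul, mul_smul, mul_smul, delta_smul_vertex, delta_smul_vertex, delta_smul,
    delta_smul]
  linear_combination 𝟏 i l * h₁ - 𝟏 k j * h₂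

theorem two_brYY (r s : ZMod m) (i j k l : Idx m n) : (2 : ℂ) • brYY d n r s i j k l =
    cdelta d n r (s + 1) * (𝟏 k j * (𝐘 r * 𝐘 s) i l)
      - cdelta d n s (r + 1) * ((𝐘 s * 𝐘 r) k j * 𝟏 i l) := by
  have h₁ : delta r (s + 1) • (𝐘 r * 𝐘 (r - 1)) i l = delta r (s + 1) • (𝐘 r * 𝐘 s) i l :=
    delta_smul_congr fun h => by rw [h, add_sub_cancel_right]
  have h₂ : delta s (r + 1) • (𝐘 (r + 1) * 𝐘 r) k j = delta s (r + 1) • (𝐘 s * 𝐘 r) k j :=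
    delta_smul_congr fun h => by rw [h]
  rw [delta_smul_vertex, delta_smul_vertex] at h₁ h₂
  rw [brYY, delta_sub_one, smul_sub, mul_assoc, mul_assoc, two_smul_half_mul_smul,
    two_smul_half_mul_smul, mul_smul, mul_smul, delta_smul_vertex, delta_smul_vertex, delta_smul,
    delta_smul]
  linear_combination 𝟏 k j * h₁ - 𝟏 i l * h₂

theorem two_brXY (r s : ZMod m) (i j k l : Idx m n) : (2 : ℂ) • brXY d n r s i j k l =
    cdelta d n s r * (2 * (𝟏 k j * 𝟏 i l) + (𝐘 s * 𝐗 r) k j * 𝟏 i l + 𝟏 k j * (𝐗 r * 𝐘 s) i l)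
      - cdelta d n r (s + 1) * (𝐗 r k j * 𝐘 s i l)
      + cdelta d n s (r + 1) * (𝐘 s k j * 𝐗 r i l) := by
  have h₁ : delta r (s + 1) • (𝐗 r k j * 𝐘 (r - 1) i l) = delta r (s + 1) • (𝐗 r k j * 𝐘 s i l) :=
    delta_smul_congr fun h => by rw [h, add_sub_cancel_right]
  have h₂ : delta s (r + 1) • (𝐘 (r + 1) k j * 𝐗 r i l) =
      delta s (r + 1) • (𝐘 s k j * 𝐗 r i l) :=
    delta_smul_congr fun h => by rw [h]
  have h₃ : delta s r • (𝐘 r * 𝐗 r) k j = delta s r • (𝐘 s * 𝐗 r) k j :=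
    delta_smul_congr fun h => by rw [h]
  have h₄ : delta s r • (𝐗 r * 𝐘 r) i l = delta s r • (𝐗 r * 𝐘 s) i l :=
    delta_smul_congr fun h => by rw [h]
  rw [delta_smul_vertex, delta_smul_vertex] at h₁ h₂ h₃ h₄
  have h₅ : (2 : ℂ) • (1 : Reg d n) = 2 := by
    rw [two_smul, one_add_one_eq_two]
  rw [brXY, delta_sub_one, smul_add, smul_sub, two_smul_half_mul_smul, two_smul_half_mul_smul,
    smul_comm (2 : ℂ) (delta s r), smul_add (2 : ℂ), smul_add (2 : ℂ), two_smul_half_mul_smul,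
    two_smul_half_mul_smul, smul_comm (2 : ℂ) (delta k j * delta i l), h₅, mul_smul]
  simp only [delta_smul_vertex, delta_smul]
  linear_combination -h₁ + h₂ + 𝟏 i l * h₃ + 𝟏 k j * h₄

/-- The rows `V_{s,α}`, as linear forms on `𝒱_cyc`. -/
def Vcycmat (s : ZMod m) : Matrix (Fin (d s)) (Idx m n) (Reg d n) := .of (Vcyc (coord d n) s)

/-- The columns `W_{s,α}`, as vectors of `𝒱_cyc`. -/
def Wcycmat (s : ZMod m) : Matrix (Idx m n) (Fin (d s)) (Reg d n) :=
  .of fun i α => Wcyc (coord d n) s α i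

local notation "𝐕" => Vcycmat d n
local notation "𝐖" => Wcycmat d n

theorem two_brXW (r s : ZMod m) (α : Fin (d s)) (i j k : Idx m n) :
    (2 : ℂ) • brXW d n r s α i j k = cdelta d n s (r + 1) * ((𝐗 r * 𝐖 s) i α * 𝟏 k j)
      - cdelta d n s r * (𝐖 s i α * 𝐗 r k j) := by
  have h : (𝐗 r *ᵥ Wcyc (coord d n) s α) i = (𝐗 r * 𝐖 s) i α := rfl
  rw [brXW, h, delta_comm r s, smul_sub, mul_assoc, two_smul_half_mul_smul,
    two_smul_half_mul_smul, mul_smul, delta_smul_vertex, delta_smul_vertex, delta_smul]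
  simp only [Wcycmat, of_apply]
  ring

theorem two_brYW (r s : ZMod m) (α : Fin (d s)) (i j k : Idx m n) :
    (2 : ℂ) • brYW d n r s α i j k = cdelta d n s r * ((𝐘 r * 𝐖 s) i α * 𝟏 k j)
      - cdelta d n s (r + 1) * (𝐖 s i α * 𝐘 r k j) := by
  have h : (𝐘 r *ᵥ Wcyc (coord d n) s α) i = (𝐘 r * 𝐖 s) i α := rfl
  rw [brYW, h, delta_comm r s, smul_sub, mul_assoc, two_smul_half_mul_smul,
    two_smul_half_mul_smul, mul_smul, delta_smul_vertex, delta_smul_vertex, delta_smul]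
  simp only [Wcycmat, of_apply]
  ring

theorem two_brXV (r s : ZMod m) (α : Fin (d s)) (i j l : Idx m n) :
    (2 : ℂ) • brXV d n r s α i j l = cdelta d n s r * (𝟏 i l * (𝐕 s * 𝐗 r) α j)
      - cdelta d n s (r + 1) * (𝐗 r i l * 𝐕 s α j) := by
  have h : (Vcyc (coord d n) s α ᵥ* 𝐗 r) j = (𝐕 s * 𝐗 r) α j := rfl
  rw [brXV, h, delta_comm r s, smul_sub, mul_assoc, two_smul_half_mul_smul,
    two_smul_half_mul_smul, mul_smul, delta_smul_vertex, delta_smul_vertex, delta_smul]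
  simp only [Vcycmat, of_apply]
  ring

theorem two_brYV (r s : ZMod m) (α : Fin (d s)) (i j l : Idx m n) :
    (2 : ℂ) • brYV d n r s α i j l = cdelta d n s (r + 1) * (𝟏 i l * (𝐕 s * 𝐘 r) α j)
      - cdelta d n s r * (𝐘 r i l * 𝐕 s α j) := by
  have h : (Vcyc (coord d n) s α ᵥ* 𝐘 r) j = (𝐕 s * 𝐘 r) α j := rfl
  rw [brYV, h, delta_comm r s, smul_sub, mul_assoc, two_smul_half_mul_smul,
    two_smul_half_mul_smul, mul_smul, delta_smul_vertex, delta_smul_vertex, delta_smul]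
  simp only [Vcycmat, of_apply]
  ring

theorem brXX_swap (r s : ZMod m) (i j k l : Idx m n) :
    brXX d n r s i j k l = -brXX d n s r k l i j := by
  apply smul_right_injective _ (two_ne_zero' ℂ)
  simp only [smul_neg, two_brXX]
  ring

theorem brYY_swap (r s : ZMod m) (i j k l : Idx m n) :
    brYY d n r s i j k l = -brYY d n s r k l i j := by
  apply smul_right_injective _ (two_ne_zero' ℂ)
  simp only [smul_neg, two_brYY]
  ring

theorem brVV_swap (s : ZMod m) (α : Fin (d s)) (r : ZMod m) (β : Fin (d r)) (j l : Idx m n) :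
    brVV d n s α r β j l = -brVV d n r β s α l j := by
  rw [brVV, brVV, ordZ_swap s r, ordF_swap α β, delta_comm r s]
  simp only [Algebra.smul_def, map_mul, map_neg]
  ring

theorem brWW_swap (s : ZMod m) (α : Fin (d s)) (r : ZMod m) (β : Fin (d r)) (i k : Idx m n) :
    brWW d n s α r β i k = -brWW d n r β s α k i := by
  rw [brWW, brWW, ordZ_swap s r, ordF_swap α β, delta_comm r s]
  simp only [Algebra.smul_def, map_mul, map_neg]
  ring

/-- Brackets of coordinates of different kinds are antisymmetric by definition, so only the four
kinds paired with themselves need proof. -/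
theorem brCoord_swap (a b : Coord m d n) : brCoord d n a b = -brCoord d n b a := by
  cases a <;> cases b <;> simp only [brCoord, neg_neg]
  exacts [brXX_swap .., brYY_swap .., brVV_swap .., brWW_swap ..]

theorem bracket_apply (F G : Reg d n) : bracket d n F G =
    ∑ a, ∑ b, partialDeriv a F * partialDeriv b G * brCoord d n a b := rfl

theorem isSkewBiderivation_bracket : IsSkewBiderivation (bracket d n) where
  skew F G := by
    rw [bracket_apply, bracket_apply, Finset.sum_comm, ← Finset.sum_neg_distrib]
    refine Finset.sum_congr rfl fun a _ => ?_
    rw [← Finset.sum_neg_distrib]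
    refine Finset.sum_congr rfl fun b _ => ?_
    rw [brCoord_swap]
    ring
  leibniz F G H := by
    simp only [bracket_apply, Derivation.leibniz, smul_eq_mul, Finset.sum_mul, Finset.mul_sum, ←
      Finset.sum_add_distrib]
    refine Finset.sum_congr rfl fun a _ => Finset.sum_congr rfl fun b _ => ?_
    ring

end Bracket

end CyclicQuiver
end

noncomputable section

theorem IsSkewBiderivation.smul {R A : Type*} [CommRing R] [CommRing A] [Algebra R A]
    {B : A →ₗ[R] A →ₗ[R] A} (hB : IsSkewBiderivation B) (c : R) : IsSkewBiderivation (c • B) where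
  skew F G := by simp only [LinearMap.smul_apply]; rw [hB.skew, smul_neg]
  leibniz F G H := by
    simp only [LinearMap.smul_apply, hB.leibniz, smul_add, smul_mul_assoc, mul_smul_comm]

theorem jacobiator_smul {R A : Type*} [CommRing R] [CommRing A] [Algebra R A]
    (B : A →ₗ[R] A →ₗ[R] A) (c : R) (F G H : A) :
    jacobiator (c • B) F G H = (c * c) • jacobiator B F G H := by
  simp only [jacobiator, LinearMap.smul_apply, map_smul, smul_smul, smul_add]

/-! ### Brackets with the entries of `T_s` -/

namespace CyclicQuiver

open Matrix

variable {m : ℕ} [NeZero m] (d n : ZMod m → ℕ)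

local notation "𝐗" => Xcyc (coord d n)
local notation "𝐘" => Ycyc (coord d n)
local notation "𝟏" => (1 : Matrix (Idx m n) (Idx m n) (Reg d n))
local notation "𝐕" => Vcycmat d n
local notation "𝐖" => Wcycmat d n

/-- Twice the quasi-Poisson bracket. -/
def twoBracket : Reg d n →ₗ[ℂ] Reg d n →ₗ[ℂ] Reg d n := (2 : ℂ) • bracket d n

local notation "𝐁" => twoBracket d n
local notation "𝐓" => Tmat (coord d n)

theorem isSkewBiderivation_twoBracket : IsSkewBiderivation 𝐁 :=
  (isSkewBiderivation_bracket d n).smul 2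

theorem twoBracket_coord (a b : Coord m d n) :
    𝐁 (coord d n a) (coord d n b) = (2 : ℂ) • brCoord d n a b := by
  rw [twoBracket, LinearMap.smul_apply, LinearMap.smul_apply, bracket_coord]

variable {d n}

/-- The bracket with an entry of `T_s`, from the brackets with the entries of `X_s` and `Y_s`. -/
theorem twoBracket_Tmat {s : ZMod m} {z : Reg d n} {P Q : Matrix (Idx m n) (Idx m n) (Reg d n)}
    (i j : Fin (n s)) (hP : ∀ a, 𝐁 (coord d n (.X s i a)) z = P ⟨s, i⟩ ⟨s + 1, a⟩)
    (hQ : ∀ a, 𝐁 (coord d n (.Y s a j)) z = Q ⟨s + 1, a⟩ ⟨s, j⟩) :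
    𝐁 (𝐓 s i j) z = (P * 𝐘 s + 𝐗 s * Q) ⟨s, i⟩ ⟨s, j⟩ := by
  have h1 : 𝐁 ((1 : Matrix (Fin (n s)) (Fin (n s)) (Reg d n)) i j) z = 0 := by
    rw [(isSkewBiderivation_twoBracket d n).skew,
      VertexRelations.bracket_one (isSkewBiderivation_twoBracket d n), neg_zero]
  rw [Tmat, Matrix.add_apply, map_add, LinearMap.add_apply, h1, zero_add, mul_apply, map_sum,
    LinearMap.sum_apply, Matrix.add_apply, Ycyc, Xcyc, mul_block_apply, block_mul_apply,
    ← Finset.sum_add_distrib]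
  refine Finset.sum_congr rfl fun a _ => ?_
  rw [(isSkewBiderivation_twoBracket d n).leibniz_left, ← hP, ← hQ]
  rfl

/-- The two contributions for `r = s + 1`, from the brackets of `X_r` with `X_s` and with `Y_s`,
become the same product and cancel. The matrices `P` and `Q` are these brackets, written on `𝒱_cyc`.
-/
theorem twoBracket_Tmat_X (s r : ZMod m) (i j : Fin (n s)) (k : Fin (n r)) (l : Fin (n (r + 1))) :
    𝐁 (𝐓 s i j) (coord d n (.X r k l)) =
      (cdelta d n s (r + 1) • (colMulRow 𝟏 (𝐗 r * (𝐗 s * 𝐘 s)) ⟨r + 1, l⟩ ⟨r, k⟩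
          - colMulRow (𝐗 s * 𝐘 s) (𝐗 r) ⟨r + 1, l⟩ ⟨r, k⟩)
        - cdelta d n s r • ((2 : Reg d n) • colMulRow (𝐗 s) 𝟏 ⟨r + 1, l⟩ ⟨r, k⟩
          + colMulRow (𝐗 s * (𝐘 s * 𝐗 r)) 𝟏 ⟨r + 1, l⟩ ⟨r, k⟩
          + colMulRow (𝐗 s) (𝐗 r * 𝐘 s) ⟨r + 1, l⟩ ⟨r, k⟩)) ⟨s, i⟩ ⟨s, j⟩ := by
  rw [twoBracket_Tmat (P := cdelta d n s (r + 1) • colMulRow 𝟏 (𝐗 r * 𝐗 s) ⟨r + 1, l⟩ ⟨r, k⟩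
      - cdelta d n r (s + 1) • colMulRow (𝐗 s * 𝐗 r) 𝟏 ⟨r + 1, l⟩ ⟨r, k⟩)
    (Q := -(cdelta d n s r • ((2 : Reg d n) • colMulRow 𝟏 𝟏 ⟨r + 1, l⟩ ⟨r, k⟩
        + colMulRow (𝐘 s * 𝐗 r) 𝟏 ⟨r + 1, l⟩ ⟨r, k⟩ + colMulRow 𝟏 (𝐗 r * 𝐘 s) ⟨r + 1, l⟩ ⟨r, k⟩))
      + cdelta d n r (s + 1) • colMulRow (𝐗 r) (𝐘 s) ⟨r + 1, l⟩ ⟨r, k⟩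
      - cdelta d n s (r + 1) • colMulRow (𝐘 s) (𝐗 r) ⟨r + 1, l⟩ ⟨r, k⟩)]
  · simp only [Matrix.mul_add, Matrix.sub_mul, Matrix.mul_sub, Matrix.mul_neg,
      Matrix.smul_mul, Matrix.mul_smul, mul_colMulRow, colMulRow_mul, Matrix.mul_one,
      Matrix.one_mul, Matrix.add_apply, Matrix.sub_apply, Matrix.neg_apply, Matrix.smul_apply,
      smul_eq_mul, colMulRow_apply, Matrix.mul_assoc]
    ring
  · intro a
    rw [twoBracket_coord, brCoord, two_brXX]
    simp only [Matrix.sub_apply, Matrix.smul_apply, smul_eq_mul, colMulRow_apply]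
    ring
  · intro a
    rw [twoBracket_coord, brCoord, smul_neg, two_brXY, cdelta_comm d n s r]
    simp only [Matrix.add_apply, Matrix.sub_apply, Matrix.neg_apply, Matrix.smul_apply, smul_eq_mul,
      colMulRow_apply]
    ring

theorem twoBracket_Tmat_Y (s r : ZMod m) (i j : Fin (n s)) (k : Fin (n (r + 1))) (l : Fin (n r)) :
    𝐁 (𝐓 s i j) (coord d n (.Y r k l)) =
      (cdelta d n s r • ((2 : Reg d n) • colMulRow 𝟏 (𝐘 s) ⟨r, l⟩ ⟨r + 1, k⟩
          + colMulRow 𝟏 (𝐘 r * (𝐗 s * 𝐘 s)) ⟨r, l⟩ ⟨r + 1, k⟩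
          + colMulRow (𝐗 s * 𝐘 r) (𝐘 s) ⟨r, l⟩ ⟨r + 1, k⟩)
        + cdelta d n s (r + 1) • (colMulRow (𝐗 s * (𝐘 s * 𝐘 r)) 𝟏 ⟨r, l⟩ ⟨r + 1, k⟩
          - colMulRow (𝐘 r) (𝐗 s * 𝐘 s) ⟨r, l⟩ ⟨r + 1, k⟩)) ⟨s, i⟩ ⟨s, j⟩ := by
  rw [twoBracket_Tmat (P := cdelta d n s r • ((2 : Reg d n) • colMulRow 𝟏 𝟏 ⟨r, l⟩ ⟨r + 1, k⟩
        + colMulRow 𝟏 (𝐘 r * 𝐗 s) ⟨r, l⟩ ⟨r + 1, k⟩ + colMulRow (𝐗 s * 𝐘 r) 𝟏 ⟨r, l⟩ ⟨r + 1, k⟩)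
      - cdelta d n s (r + 1) • colMulRow (𝐘 r) (𝐗 s) ⟨r, l⟩ ⟨r + 1, k⟩
      + cdelta d n r (s + 1) • colMulRow (𝐗 s) (𝐘 r) ⟨r, l⟩ ⟨r + 1, k⟩)
    (Q := cdelta d n s (r + 1) • colMulRow (𝐘 s * 𝐘 r) 𝟏 ⟨r, l⟩ ⟨r + 1, k⟩
      - cdelta d n r (s + 1) • colMulRow 𝟏 (𝐘 r * 𝐘 s) ⟨r, l⟩ ⟨r + 1, k⟩)]
  · simp only [Matrix.add_mul, Matrix.sub_mul, Matrix.mul_sub,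
      Matrix.smul_mul, Matrix.mul_smul, mul_colMulRow, colMulRow_mul, Matrix.mul_one,
      Matrix.one_mul, Matrix.add_apply, Matrix.sub_apply, Matrix.smul_apply,
      smul_eq_mul, colMulRow_apply, Matrix.mul_assoc]
    ring
  · intro a
    rw [twoBracket_coord, brCoord, two_brXY, cdelta_comm d n r s]
    simp only [Matrix.add_apply, Matrix.sub_apply, Matrix.smul_apply, smul_eq_mul, colMulRow_apply]
    ring
  · intro a
    rw [twoBracket_coord, brCoord, two_brYY]
    simp only [Matrix.sub_apply, Matrix.smul_apply, smul_eq_mul, colMulRow_apply]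
    ring

/-- The remaining neighbour terms, with `s = r + 1`, cancel between `P * Y_r` and `X_r * Q`. So do
the terms in which `X_r * Y_s` multiplies `X_s * Y_r`. -/
theorem twoBracket_Tmat_Tmat (r s : ZMod m) (k l : Fin (n r)) (i j : Fin (n s)) :
    𝐁 (𝐓 r k l) (𝐓 s i j) = (cdelta d n s r •
      ((2 : Reg d n) • colMulRow 𝟏 (𝐗 s * 𝐘 r) ⟨s, j⟩ ⟨s, i⟩
        + colMulRow 𝟏 (𝐗 s * (𝐘 s * (𝐗 r * 𝐘 r))) ⟨s, j⟩ ⟨s, i⟩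
        - (2 : Reg d n) • colMulRow (𝐗 r * 𝐘 s) 𝟏 ⟨s, j⟩ ⟨s, i⟩
        - colMulRow (𝐗 r * (𝐘 r * (𝐗 s * 𝐘 s))) 𝟏 ⟨s, j⟩ ⟨s, i⟩)) ⟨r, k⟩ ⟨r, l⟩ := by
  rw [twoBracket_Tmat (P := cdelta d n s r • ((2 : Reg d n) • colMulRow 𝟏 (𝐗 s) ⟨s, j⟩ ⟨s, i⟩
        + colMulRow 𝟏 (𝐗 s * (𝐘 s * 𝐗 r)) ⟨s, j⟩ ⟨s, i⟩
        + colMulRow (𝐗 r * 𝐘 s) (𝐗 s) ⟨s, j⟩ ⟨s, i⟩)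
      - cdelta d n s (r + 1) • (colMulRow (𝐗 r * (𝐗 s * 𝐘 s)) 𝟏 ⟨s, j⟩ ⟨s, i⟩
        - colMulRow (𝐗 r) (𝐗 s * 𝐘 s) ⟨s, j⟩ ⟨s, i⟩))
    (Q := -(cdelta d n s r • ((2 : Reg d n) • colMulRow (𝐘 s) 𝟏 ⟨s, j⟩ ⟨s, i⟩
        + colMulRow (𝐘 r * (𝐗 s * 𝐘 s)) 𝟏 ⟨s, j⟩ ⟨s, i⟩
        + colMulRow (𝐘 s) (𝐗 s * 𝐘 r) ⟨s, j⟩ ⟨s, i⟩))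
      - cdelta d n s (r + 1) • (colMulRow 𝟏 (𝐗 s * (𝐘 s * 𝐘 r)) ⟨s, j⟩ ⟨s, i⟩
        - colMulRow (𝐗 s * 𝐘 s) (𝐘 r) ⟨s, j⟩ ⟨s, i⟩))]
  · simp only [Matrix.add_mul, Matrix.mul_add, Matrix.sub_mul, Matrix.mul_sub, Matrix.mul_neg,
      Matrix.smul_mul, Matrix.mul_smul, mul_colMulRow, colMulRow_mul, Matrix.mul_one,
      Matrix.one_mul, Matrix.add_apply, Matrix.sub_apply, Matrix.neg_apply, Matrix.smul_apply,
      smul_eq_mul, colMulRow_apply, Matrix.mul_assoc]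
    ring
  · intro a
    rw [(isSkewBiderivation_twoBracket d n).skew, twoBracket_Tmat_X]
    simp only [Matrix.add_apply, Matrix.sub_apply, Matrix.smul_apply, smul_eq_mul, colMulRow_apply]
    ring
  · intro a
    rw [(isSkewBiderivation_twoBracket d n).skew, twoBracket_Tmat_Y]
    simp only [Matrix.add_apply, Matrix.sub_apply, Matrix.neg_apply, Matrix.smul_apply, smul_eq_mul,
      colMulRow_apply]
    ring

/-- For `r = s + 1` the factors `X_s` and `Y_s` contribute `X_s W_r` times `Y_s` with opposite
signs, leaving only `r = s`. -/
theorem twoBracket_Tmat_W (s r : ZMod m) (i j : Fin (n s)) (k : Fin (n r)) (α : Fin (d r)) :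
    𝐁 (𝐓 s i j) (coord d n (.W r α k)) =
      (cdelta d n r s • (colMulRow (𝐗 s * (𝐘 s * 𝐖 r)) 𝟏 α ⟨r, k⟩
        - colMulRow (𝐖 r) (𝐗 s * 𝐘 s) α ⟨r, k⟩)) ⟨s, i⟩ ⟨s, j⟩ := by
  rw [twoBracket_Tmat (P := cdelta d n r (s + 1) • colMulRow (𝐗 s * 𝐖 r) 𝟏 α ⟨r, k⟩
      - cdelta d n r s • colMulRow (𝐖 r) (𝐗 s) α ⟨r, k⟩)
    (Q := cdelta d n r s • colMulRow (𝐘 s * 𝐖 r) 𝟏 α ⟨r, k⟩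
      - cdelta d n r (s + 1) • colMulRow (𝐖 r) (𝐘 s) α ⟨r, k⟩)]
  · simp only [Matrix.sub_mul, Matrix.mul_sub,
      Matrix.smul_mul, Matrix.mul_smul, mul_colMulRow, colMulRow_mul,
      Matrix.one_mul, Matrix.add_apply, Matrix.sub_apply, Matrix.smul_apply,
      smul_eq_mul, colMulRow_apply]
    ring
  · intro a
    rw [twoBracket_coord, brCoord, two_brXW]
    rfl
  · intro a
    rw [twoBracket_coord, brCoord, two_brYW]
    rfl

theorem twoBracket_Tmat_V (s r : ZMod m) (i j : Fin (n s)) (α : Fin (d r)) (l : Fin (n r)) :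
    𝐁 (𝐓 s i j) (coord d n (.V r α l)) =
      (cdelta d n r s • (colMulRow 𝟏 (𝐕 r * (𝐗 s * 𝐘 s)) ⟨r, l⟩ α
        - colMulRow (𝐗 s * 𝐘 s) (𝐕 r) ⟨r, l⟩ α)) ⟨s, i⟩ ⟨s, j⟩ := by
  rw [twoBracket_Tmat (P := cdelta d n r s • colMulRow 𝟏 (𝐕 r * 𝐗 s) ⟨r, l⟩ α
      - cdelta d n r (s + 1) • colMulRow (𝐗 s) (𝐕 r) ⟨r, l⟩ α)
    (Q := cdelta d n r (s + 1) • colMulRow 𝟏 (𝐕 r * 𝐘 s) ⟨r, l⟩ α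
      - cdelta d n r s • colMulRow (𝐘 s) (𝐕 r) ⟨r, l⟩ α)]
  · simp only [Matrix.sub_mul, Matrix.mul_sub,
      Matrix.smul_mul, Matrix.mul_smul, mul_colMulRow, colMulRow_mul, Matrix.mul_assoc,
      Matrix.mul_one, Matrix.add_apply, Matrix.sub_apply, Matrix.smul_apply,
      smul_eq_mul, colMulRow_apply]
    ring
  · intro a
    rw [twoBracket_coord, brCoord, two_brXV]
    rfl
  · intro a
    rw [twoBracket_coord, brCoord, two_brYV]
    rfl

end CyclicQuiver
end

noncomputable section

namespace CyclicQuiver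

open Matrix

/-! ### Verification of the relations for the cyclic quiver -/

section Relations

variable {m : ℕ} [NeZero m] (d n : ZMod m → ℕ)

local notation "𝐗" => Xcyc (coord d n)
local notation "𝐘" => Ycyc (coord d n)
local notation "𝟏" => (1 : Matrix (Idx m n) (Idx m n) (Reg d n))
local notation "𝐕" => Vcycmat d n
local notation "𝐖" => Wcycmat d n
local notation "𝐁" => twoBracket d n
local notation "𝐓" => Tmat (coord d n)

variable {d n}

theorem cdelta_self (s : ZMod m) : cdelta d n s s = 1 := by simp [cdelta, delta]

theorem cdelta_of_ne {s t : ZMod m} (h : s ≠ t) : cdelta d n s t = 0 := by simp [cdelta, delta, h]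

theorem one_vertex_apply (s : ZMod m) (i j : Fin (n s)) :
    𝟏 ⟨s, i⟩ ⟨s, j⟩ = (1 : Matrix (Fin (n s)) (Fin (n s)) (Reg d n)) i j := by
  simp [one_apply]

theorem Xcyc_mul_Ycyc (s : ZMod m) : 𝐗 s * 𝐘 s = block (𝐓 s - 1) := by
  rw [Xcyc, Ycyc, block_mul_block, Tmat, add_sub_cancel_left]

theorem Xcyc_mul_Ycyc_sq (s : ZMod m) :
    𝐗 s * (𝐘 s * (𝐗 s * 𝐘 s)) = block (𝐓 s * 𝐓 s - 𝐓 s - 𝐓 s + 1) := by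
  rw [← Matrix.mul_assoc, Xcyc_mul_Ycyc, block_mul_block]
  congr 1
  noncomm_ring

theorem Vcycmat_apply (s : ZMod m) (α : Fin (d s)) (j : Fin (n s)) :
    𝐕 s α ⟨s, j⟩ = Vmat (coord d n) s α j :=
  incl_mulVec_apply s _ j

theorem Wcycmat_apply (s : ZMod m) (i : Fin (n s)) (α : Fin (d s)) :
    𝐖 s ⟨s, i⟩ α = Wmat (coord d n) s i α :=
  incl_mulVec_apply s _ i

theorem Vcycmat_mul_block_apply (s : ZMod m) (M : Matrix (Fin (n s)) (Fin (n s)) (Reg d n))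
    (α : Fin (d s)) (j : Fin (n s)) :
    (𝐕 s * block M) α ⟨s, j⟩ = (Vmat (coord d n) s * M) α j := by
  rw [mul_block_apply, mul_apply]
  simp only [Vcycmat_apply]

theorem block_mul_Wcycmat_apply (s : ZMod m) (M : Matrix (Fin (n s)) (Fin (n s)) (Reg d n))
    (i : Fin (n s)) (α : Fin (d s)) :
    (block M * 𝐖 s) ⟨s, i⟩ α = (M * Wmat (coord d n) s) i α := by
  rw [block_mul_apply, mul_apply]
  simp only [Wcycmat_apply]

theorem ordZ_self (s : ZMod m) : ordZ s s = 0 := by simp [ordZ]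

theorem delta_self {ι : Type*} [DecidableEq ι] (i : ι) : delta i i = 1 := by simp [delta]

theorem algebraMap_ordF {a : ℕ} (α β : Fin a) :
    algebraMap ℂ (Reg d n) (ordF α β) = ordSign (Reg d n) α β := by
  rcases lt_trichotomy α β with h | rfl | h
  · have h' : (0 : ℤ) < ((β : ℕ) : ℤ) - ((α : ℕ) : ℤ) := by
      have : (α : ℕ) < β := h
      omega
    rw [ordSign_of_lt h, ordF, sign_pos h']
    simp
  · simp [ordF]
  · have h' : ((β : ℕ) : ℤ) - ((α : ℕ) : ℤ) < 0 := by
      have : (β : ℕ) < α := h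
      omega
    rw [ordSign_of_gt h, ordF, sign_neg h']
    simp

theorem two_mul_algebraMap_half : 2 * algebraMap ℂ (Reg d n) (1 / 2) = 1 := by
  rw [← map_ofNat (algebraMap ℂ (Reg d n)) 2, ← map_mul]
  norm_num

theorem algebraMap_delta_fin {a : ℕ} (α β : Fin a) :
    algebraMap ℂ (Reg d n) (delta (α : ℕ) (β : ℕ)) =
      (1 : Matrix (Fin a) (Fin a) (Reg d n)) α β := by
  by_cases h : α = β
  · rw [h, one_apply_eq, delta, if_pos rfl, map_one]
  · rw [one_apply_ne h, delta, if_neg (fun h' => h (Fin.ext h')), map_zero]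

theorem algebraMap_delta (i j : Idx m n) : algebraMap ℂ (Reg d n) (delta i j) = 𝟏 i j := by
  have := delta_smul d n i j 1
  rwa [mul_one, Algebra.smul_def, mul_one] at this

/-- The brackets at the vertex `s`. -/
theorem vertexRelations (s : ZMod m) :
    VertexRelations 𝐁 (𝐓 s) (Vmat (coord d n) s) (Wmat (coord d n) s) where
  toIsSkewBiderivation := isSkewBiderivation_twoBracket d n
  TT i j k l := by
    -- With `X Y = T - 1` the coefficients combine as `2 (T - 1) + (T - 1)² = T² - 1`, and the
    -- constants cancel by antisymmetry.
    rw [twoBracket_Tmat_Tmat, cdelta_self, one_smul, Xcyc_mul_Ycyc_sq, Xcyc_mul_Ycyc]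
    simp only [Matrix.add_apply, Matrix.sub_apply, Matrix.smul_apply, smul_eq_mul, colMulRow_apply,
      block_apply, one_vertex_apply]
    ring
  TW i j k γ := by
    have h := twoBracket_Tmat_W (d := d) (n := n) s s i j k γ
    rw [cdelta_self, one_smul, ← Matrix.mul_assoc, Xcyc_mul_Ycyc] at h
    refine h.trans ?_
    simp only [Matrix.sub_apply, colMulRow_apply, block_apply, one_vertex_apply,
      block_mul_Wcycmat_apply, Wcycmat_apply, Matrix.sub_mul, Matrix.one_mul]
    ring
  TV i j γ l := by
    have h := twoBracket_Tmat_V (d := d) (n := n) s s i j γ l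
    rw [cdelta_self, one_smul, Xcyc_mul_Ycyc] at h
    refine h.trans ?_
    simp only [Matrix.sub_apply, colMulRow_apply, block_apply, one_vertex_apply,
      Vcycmat_mul_block_apply, Vcycmat_apply, Matrix.mul_sub, Matrix.mul_one]
    ring
  VV α j β l := by
    have h := twoBracket_coord d n (.V s α j) (.V s β l)
    refine h.trans ?_
    have h1 (α : Fin (d s)) (j : Fin (n s)) :
      Vcyc (coord d n) s α ⟨s, j⟩ = Vmat (coord d n) s α j := Vcycmat_apply s α j
    rw [brCoord, brVV, ordZ_self, delta_self, mul_zero, zero_smul, neg_zero, zero_sub, mul_one,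
      smul_neg, two_smul_half_mul_smul, Algebra.smul_def, algebraMap_ordF, h1, h1, h1, h1]
  WW i α k β := by
    have h := twoBracket_coord d n (.W s α i) (.W s β k)
    refine h.trans ?_
    have h1 (α : Fin (d s)) (j : Fin (n s)) :
      Wcyc (coord d n) s α ⟨s, j⟩ = Wmat (coord d n) s j α := Wcycmat_apply s j α
    rw [brCoord, brWW, ordZ_self, delta_self, mul_zero, zero_smul, neg_zero, zero_sub, mul_one,
      smul_neg, two_smul_half_mul_smul, Algebra.smul_def, algebraMap_ordF, h1, h1, h1, h1]
  VW α j k β := by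
    have h := twoBracket_coord d n (.V s α j) (.W s β k)
    refine h.trans ?_
    have hV (α : Fin (d s)) (j : Fin (n s)) :
      Vcyc (coord d n) s α ⟨s, j⟩ = Vmat (coord d n) s α j := Vcycmat_apply s α j
    have hW (α : Fin (d s)) (j : Fin (n s)) :
      Wcyc (coord d n) s α ⟨s, j⟩ = Wmat (coord d n) s j α := Wcycmat_apply s j α
    have hVW : Vcyc (coord d n) s α ⬝ᵥ Wcyc (coord d n) s β =
        (Vmat (coord d n) s * Wmat (coord d n) s) α β := by
      rw [Vcyc, Wcyc, ← vecMul_transpose, ← dotProduct_mulVec, mulVec_mulVec,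
        incl_transpose_mul_incl, one_mulVec]
      rfl
    rw [brCoord, brVW, ordZ_self, delta_self, mul_zero, zero_smul, zero_add, mul_one, one_mul,
      smul_add, two_smul_half_mul_smul, hVW, hV, hW]
    simp only [Algebra.smul_def, map_mul, algebraMap_ordF, algebraMap_delta_fin, algebraMap_delta,
      one_vertex_apply]
    have := two_mul_algebraMap_half (d := d) (n := n)
    rw [map_ofNat]
    -- The halves inside the summand with `delta α β` still stand next to the outer factor 2.
    linear_combination (1 : Matrix (Fin (d s)) (Fin (d s)) (Reg d n)) α β *
      (Wmat (coord d n) s k β * Vmat (coord d n) s α j +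
      (1 : Matrix (Fin (n s)) (Fin (n s)) (Reg d n)) k j *
        (Vmat (coord d n) s * Wmat (coord d n) s) α β) * this

theorem quiverRelations : QuiverRelations 𝐁 𝐓 (Vmat (coord d n)) (Wmat (coord d n))
    (fun s r => algebraMap ℂ (Reg d n) (ordZ s r)) where
  toIsSkewBiderivation := isSkewBiderivation_twoBracket d n
  vertex := vertexRelations
  TT s r hsr i j k l := by
    rw [twoBracket_Tmat_Tmat, cdelta_of_ne hsr.symm, zero_smul, Matrix.zero_apply]
  TV s r hsr i j α k := by
    refine (twoBracket_Tmat_V (d := d) (n := n) s r i j α k).trans ?_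
    rw [cdelta_of_ne hsr.symm, zero_smul, Matrix.zero_apply]
  TW s r hsr i j k α := by
    refine (twoBracket_Tmat_W (d := d) (n := n) s r i j k α).trans ?_
    rw [cdelta_of_ne hsr.symm, zero_smul, Matrix.zero_apply]
  VV s r hsr α j β l := by
    refine (twoBracket_coord d n (.V s α j) (.V r β l)).trans ?_
    have h1 (s : ZMod m) (α : Fin (d s)) (j : Fin (n s)) :
      Vcyc (coord d n) s α ⟨s, j⟩ = Vmat (coord d n) s α j := Vcycmat_apply s α j
    have h0 : delta s r = 0 := if_neg hsr
    rw [brCoord, brVV, h0, mul_zero, zero_mul, zero_smul, sub_zero, smul_neg,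
      two_smul_half_mul_smul, Algebra.smul_def, h1, h1, mul_assoc]
  VW s r hsr α j k β := by
    refine (twoBracket_coord d n (.V s α j) (.W r β k)).trans ?_
    have hV (s : ZMod m) (α : Fin (d s)) (j : Fin (n s)) :
      Vcyc (coord d n) s α ⟨s, j⟩ = Vmat (coord d n) s α j := Vcycmat_apply s α j
    have hW (s : ZMod m) (α : Fin (d s)) (j : Fin (n s)) :
      Wcyc (coord d n) s α ⟨s, j⟩ = Wmat (coord d n) s j α := Wcycmat_apply s j α
    have h0 : delta s r = 0 := if_neg hsr
    rw [brCoord, brVW, h0, mul_zero, zero_mul, zero_mul, zero_smul, zero_smul, add_zero, add_zero,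
      two_smul_half_mul_smul, Algebra.smul_def, hV, hW]
    ring
  WW s r hsr i α k β := by
    refine (twoBracket_coord d n (.W s α i) (.W r β k)).trans ?_
    have h1 (s : ZMod m) (α : Fin (d s)) (j : Fin (n s)) :
      Wcyc (coord d n) s α ⟨s, j⟩ = Wmat (coord d n) s j α := Wcycmat_apply s j α
    have h0 : delta s r = 0 := if_neg hsr
    rw [brCoord, brWW, h0, mul_zero, zero_mul, zero_smul, sub_zero, smul_neg,
      two_smul_half_mul_smul, Algebra.smul_def, h1, h1]
    ring
  o_swap s r := by rw [ordZ_swap, map_neg]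

/-! ### The algebras `ℋ₊` and `ℐ₊` -/

theorem Iplus_eq : Iplus d n = Algebra.adjoin ℂ
    (QuiverRelations.invariants 𝐓 (Vmat (coord d n)) (Wmat (coord d n))) := by
  apply le_antisymm <;> apply Algebra.adjoin_le
  · rintro F (hF | ⟨p, α, q, β, s, k, rfl⟩)
    · exact Algebra.subset_adjoin (.inl hF)
    -- A trace composing blocks at different vertices vanishes; the others are entries of `V T ^ k
    -- W`.
    · by_cases h : p = s ∧ q = s
      · obtain ⟨rfl, rfl⟩ := h
        rw [traceWVT_self]
        exact Algebra.subset_adjoin (.inr (Set.mem_iUnion.2 ⟨_, k, β, α, rfl⟩))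
      · rw [traceWVT_eq_zero _ h]
        exact zero_mem _
  · rintro F (hF | hF)
    · exact Algebra.subset_adjoin (.inl hF)
    · obtain ⟨s, k, β, α, rfl⟩ := Set.mem_iUnion.1 hF
      rw [← traceWVT_self]
      exact Algebra.subset_adjoin (.inr ⟨s, α, s, β, s, k, rfl⟩)

theorem bracket_eq_half_twoBracket (F G : Reg d n) : bracket d n F G = (1 / 2 : ℂ) • 𝐁 F G := by
  rw [twoBracket, LinearMap.smul_apply, LinearMap.smul_apply, smul_smul]
  norm_num

/-- The Jacobiator is quadratic in the bracket, whence the square of one half. -/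
theorem jacobiator_bracket (F G H : Reg d n) :
    jacobiator (bracket d n) F G H = (1 / 4 : ℂ) • jacobiator 𝐁 F G H := by
  rw [twoBracket, jacobiator_smul, smul_smul]
  norm_num

theorem isPoissonSubalgebra_Iplus : IsPoissonSubalgebra (bracket d n) (Iplus d n) := by
  rw [Iplus_eq]
  refine (isSkewBiderivation_bracket d n).isPoissonSubalgebra_adjoin (fun F hF G hG => ?_)
    fun F hF G hG H hH => ?_
  · rw [bracket_eq_half_twoBracket]
    exact Subalgebra.smul_mem _ (quiverRelations.bracket_invariants_mem hF hG) _
  · rw [jacobiator_bracket, quiverRelations.jacobiator_invariants hF hG hH, smul_zero]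

theorem Hplus_le_Iplus : Hplus d n ≤ Iplus d n :=
  Algebra.adjoin_mono Set.subset_union_left

theorem bracket_Hplus_Iplus {F G : Reg d n} (hF : F ∈ Hplus d n) (hG : G ∈ Iplus d n) :
    bracket d n F G = 0 := by
  have hB := isSkewBiderivation_bracket d n
  rw [hB.skew, neg_eq_zero]
  refine hB.bracket_adjoin_right_eq_zero (fun H hH => ?_) hF
  rw [Iplus_eq] at hG
  rw [hB.skew, bracket_eq_half_twoBracket, quiverRelations.bracket_trace_adjoin hH hG, smul_zero,
    neg_zero]

end Relations

end CyclicQuiver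

end

theorem proposition3p3 (m : ℕ) [NeZero m] (hm : 2 ≤ m) (d n : ZMod m → ℕ) :
    (IsPoissonSubalgebra (CyclicQuiver.bracket d n) (CyclicQuiver.Hplus d n) ∧
      ∀ F ∈ CyclicQuiver.Hplus d n, ∀ G ∈ CyclicQuiver.Hplus d n,
        CyclicQuiver.bracket d n F G = 0) ∧
    (∀ (k l : ℕ) (s r p q : ZMod m) (α : Fin (d p)) (β : Fin (d q)),
      CyclicQuiver.bracket d n (CyclicQuiver.traceT (CyclicQuiver.coord d n) s k)
        (CyclicQuiver.traceWVT (CyclicQuiver.coord d n) p α q β r l) = 0) ∧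
    IsPoissonSubalgebra (CyclicQuiver.bracket d n) (CyclicQuiver.Iplus d n) ∧
    (CyclicQuiver.Hplus d n ≤ CyclicQuiver.Iplus d n ∧
      ∀ F ∈ CyclicQuiver.Hplus d n, ∀ G ∈ CyclicQuiver.Iplus d n,
        CyclicQuiver.bracket d n F G = 0) := by
  have hcomm : ∀ F ∈ CyclicQuiver.Hplus d n, ∀ G ∈ CyclicQuiver.Hplus d n,
      CyclicQuiver.bracket d n F G = 0 := fun F hF G hG =>
    CyclicQuiver.bracket_Hplus_Iplus hF (CyclicQuiver.Hplus_le_Iplus hG)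
  refine ⟨⟨?_, hcomm⟩, fun k l s r p q α β => ?_, CyclicQuiver.isPoissonSubalgebra_Iplus,
    CyclicQuiver.Hplus_le_Iplus, fun F hF G hG => CyclicQuiver.bracket_Hplus_Iplus hF hG⟩
  -- Every axiom except closure is inherited from the larger algebra; closure holds because the
  -- brackets are zero.
  · have hI := CyclicQuiver.isPoissonSubalgebra_Iplus (d := d) (n := n)
    have hle := CyclicQuiver.Hplus_le_Iplus (d := d) (n := n)
    exact {
      closed := fun F hF G hG => by
        rw [hcomm F hF G hG]
        exact zero_mem _
      skew := fun F hF G hG => hI.skew F (hle hF) G (hle hG)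
      leibniz := fun F hF G hG H hH => hI.leibniz F (hle hF) G (hle hG) H (hle hH)
      jacobi := fun F hF G hG H hH => hI.jacobi F (hle hF) G (hle hG) H (hle hH) }
  · exact CyclicQuiver.bracket_Hplus_Iplus (Algebra.subset_adjoin ⟨s, k, rfl⟩)
      (Algebra.subset_adjoin (.inr ⟨p, α, q, β, r, l, rfl⟩))
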